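/- Let $P(M,G)$ be a smooth principal bundle with projection $p:P\to M$, where $P,M$ are connected paracompact (Hausdorff, finite-dimensional) smooth manifolds and the Lie group $G$ acts smoothly on $P$ from the left. Let $\omega$ be a flat connection form on $P$, i.e. a connection form such that every point of $M$ has a neighbourhood $U$ over which some principal trivialization $p^{-1}(U)\cong U\times G$ carries $\omega$ to the canonical flat connection of $U\times G$. Let $q:\widehat M\to M$ be a regular smooth covering with $\widehat M$ connected, and let $\widehat P=\{(\widehat m,x)\in\widehat M\times P: q(\widehat m)=p(x)\}$, with projections $\widehat p:\widehat P\to\widehat M$ and $\widehat q:\widehat P\to P$, be the induced bundle, with induced form $\widehat\omega=\widehat q^{\,*}\omega$. Then $\widehat P(\widehat M,G)$ is a smooth principal bundle and $\widehat\omega$ is a flat connection form on it. Moreover let $\widehat x_0\in\widehat P$, $x_0=\widehat q(\widehat x_0)$, $\widehat m_0=\widehat p(\widehat x_0)$, $m_0=q(\widehat m_0)=p(x_0)$. There is exactly one homomorphism $h_\omega:\pi_1(M,m_0)\to G$ such that every piecewise $C^1$ loop $\gamma$ at $m_0$ has a horizontal lift starting at $x_0$ and every such lift ends at $h_\omega([\gamma])\,x_0$;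 likewise there is exactly one such homomorphism $h_{\widehat\omega}:\pi_1(\widehat M,\widehat m_0)\to G$ for $\widehat\omega$ and $\widehat x_0$. The image of $h_{\widehat\omega}$ is the holonomy group of $\widehat\omega$ at $\widehat x_0$ (the set of $g\in G$ such that $\widehat x_0$ and $g\widehat x_0$ are joined by a horizontal path), and $$\operatorname{Im}(h_{\widehat\omega})=h_\omega\bigl(q_\#\,\pi_1(\widehat M,\widehat m_0)\bigr),$$ that is, it is the image of the restriction of $h_\omega$ to the subgroup $\pi_1(\widehat M)\subseteq\pi_1(M)$. -/

import Mathlib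

open scoped Manifold ContDiff
open Set Bundle

noncomputable section

namespace FlatCovering

/-! ### Fundamental groups

Mathlib multiplies loop classes in the order of composition of functions (`[δ] * [γ]` is the class
of "first `γ`, then `δ`").  For a structure group acting from the left, holonomy is multiplicative
with respect to the usual order of concatenation, so we pass to the opposite group. -/

/-- The fundamental group `π₁(X, x)`, in which `[γ] * [δ]` is the class of "first `γ`, then `δ`". -/
abbrev PiOne (X : Type*) [TopologicalSpace X] (x : X) : Type _ := (FundamentalGroup X x)ᵐᵒᵖ

/-- The class in `π₁(X, x)` of a loop at `x`. -/
def loopClass {X : Type*} [TopologicalSpace X] {x : X} (γ : Path x x) : PiOne X x :=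
  MulOpposite.op (FundamentalGroup.fromPath (Path.Homotopic.Quotient.mk γ))

theorem loopClass_trans {X : Type*} [TopologicalSpace X] {x : X} (γ δ : Path x x) :
    loopClass (γ.trans δ) = loopClass γ * loopClass δ := rfl

/-- The homomorphism `f_# : π₁(X, x) → π₁(Y, f x)`. -/
def piOneMap {X Y : Type*} [TopologicalSpace X] [TopologicalSpace Y] (f : C(X, Y)) (x : X) :
    PiOne X x →* PiOne Y (f x) :=
  MonoidHom.op (FundamentalGroup.map f x)

theorem piOneMap_loopClass {X Y : Type*} [TopologicalSpace X] [TopologicalSpace Y] (f : C(X, Y))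
    {x : X} (γ : Path x x) :
    piOneMap f x (loopClass γ) = loopClass (γ.map f.continuous) := rfl

/-! ### Principal bundles

All manifolds are boundaryless; `EM`, `EG`, `EP` are the (finite-dimensional) model spaces of the
base `M`, the structure group `G` and the total space `P`. -/

section Principal

variable (EM EG EP : Type*)
  [NormedAddCommGroup EM] [NormedSpace ℝ EM]
  [NormedAddCommGroup EG] [NormedSpace ℝ EG]
  [NormedAddCommGroup EP] [NormedSpace ℝ EP]
  (G : Type*) [TopologicalSpace G] [ChartedSpace EG G] [Group G]
  {M P : Type*} [TopologicalSpace M] [ChartedSpace EM M]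
  [TopologicalSpace P] [ChartedSpace EP P] [MulAction G P]

variable {G} in
/-- A trivialization `p ⁻¹(U) ≅ U × G` is a smooth trivialization of principal bundles if it is a
diffeomorphism and commutes with the left actions of `G` (on `U × G`: left translation on `G`). -/
structure IsPrincipalTrivialization {p : P → M} (e : Trivialization G p) : Prop where
  smooth : ContMDiffOn 𝓘(ℝ, EP) (𝓘(ℝ, EM).prod 𝓘(ℝ, EG)) ∞ e e.source
  smooth_symm : ContMDiffOn (𝓘(ℝ, EM).prod 𝓘(ℝ, EG)) 𝓘(ℝ, EP) ∞
    e.toOpenPartialHomeomorph.symm e.target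
  equivariant : ∀ (g : G), ∀ x ∈ e.source, e (g • x) = ((e x).1, g * (e x).2)

/-- `P(M, G)` with projection `p` is a smooth principal bundle, `G` acting on `P` from the left. -/
structure IsPrincipalBundle (p : P → M) : Prop where
  smooth_smul : ContMDiff (𝓘(ℝ, EG).prod 𝓘(ℝ, EP)) 𝓘(ℝ, EP) ∞ (fun z : G × P => z.1 • z.2)
  smooth_proj : ContMDiff 𝓘(ℝ, EP) 𝓘(ℝ, EM) ∞ p
  proj_smul : ∀ (g : G) (x : P), p (g • x) = p x
  locally_trivial : ∀ m : M, ∃ e : Trivialization G p, m ∈ e.baseSet ∧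
    IsPrincipalTrivialization EM EG EP e

/-! ### Connections -/

variable {G} in
/-- The adjoint representation: the derivative at `1` of `h ↦ g h g⁻¹`. -/
def Ad (g : G) : GroupLieAlgebra 𝓘(ℝ, EG) G →L[ℝ] GroupLieAlgebra 𝓘(ℝ, EG) G :=
  mfderiv 𝓘(ℝ, EG) 𝓘(ℝ, EG) (fun h : G => g * h * g⁻¹) 1

variable {G} in
/-- The right-invariant Maurer-Cartan form `T_a G → T_1 G`: the derivative at `a` of `h ↦ h a⁻¹`. -/
def maurerCartan (a : G) : TangentSpace 𝓘(ℝ, EG) a →L[ℝ] GroupLieAlgebra 𝓘(ℝ, EG) G :=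
  mfderiv 𝓘(ℝ, EG) 𝓘(ℝ, EG) (fun h : G => h * a⁻¹) a

variable (P) in
/-- One-forms on `P` with values in the Lie algebra of `G` (no regularity imposed). -/
abbrev LieForm : Type _ :=
  (x : P) → TangentSpace 𝓘(ℝ, EP) x →L[ℝ] GroupLieAlgebra 𝓘(ℝ, EG) G

variable {G}

/-- `α` is a (smooth) connection form: it reproduces the generators of the fundamental vector
fields, and it is equivariant. -/
structure IsConnectionForm [IsManifold 𝓘(ℝ, EP) ∞ P] (α : LieForm EG EP G P) : Prop where
  smooth : ContMDiff (M' := EG) 𝓘(ℝ, EP).tangent 𝓘(ℝ, EG) ∞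
    (fun v : TangentBundle 𝓘(ℝ, EP) P => α v.1 v.2)
  fundamental : ∀ (x : P) (A : GroupLieAlgebra 𝓘(ℝ, EG) G),
    α ((1 : G) • x) (mfderiv 𝓘(ℝ, EG) 𝓘(ℝ, EP) (fun g : G => g • x) 1 A) = A
  equivariant : ∀ (g : G) (x : P) (v : TangentSpace 𝓘(ℝ, EP) x),
    α (g • x) (mfderiv 𝓘(ℝ, EP) 𝓘(ℝ, EP) (fun y : P => g • y) x v) = Ad EG g (α x v)

/-- The connection form `α` is flat: every point of `M` has a neighbourhood `U` such that, under a
principal trivialization `p ⁻¹(U) ≅ U × G`, `α` is the canonical flat connection of `U × G`, that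
is, the pull-back of the Maurer-Cartan form under `U × G → G`. -/
def IsFlat (p : P → M) (α : LieForm EG EP G P) : Prop :=
  ∀ m : M, ∃ e : Trivialization G p, m ∈ e.baseSet ∧ IsPrincipalTrivialization EM EG EP e ∧
    ∀ x ∈ e.source, ∀ v : TangentSpace 𝓘(ℝ, EP) x,
      α x v = maurerCartan EG (e x).2 (mfderiv 𝓘(ℝ, EP) 𝓘(ℝ, EG) (fun y : P => (e y).2) x v)

/-! ### Horizontal lifts and holonomy -/

/-- `γ` is of class `C¹` on every closed subinterval of `[0, 1]` with no point of `S` inside. -/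
def IsC1Off (E : Type*) [NormedAddCommGroup E] [NormedSpace ℝ E]
    {X : Type*} [TopologicalSpace X] [ChartedSpace E X] {a b : X} (γ : Path a b)
    (S : Finset ℝ) : Prop :=
  ∀ s t : ℝ, 0 ≤ s → s < t → t ≤ 1 → Disjoint (Ioo s t) (S : Set ℝ) →
    ContMDiffOn 𝓘(ℝ, ℝ) 𝓘(ℝ, E) 1 γ.extend (Icc s t)

/-- Piecewise `C¹` paths (continuous, with finitely many break points). -/
def IsPiecewiseC1 (E : Type*) [NormedAddCommGroup E] [NormedSpace ℝ E]
    {X : Type*} [TopologicalSpace X] [ChartedSpace E X] {a b : X} (γ : Path a b) : Prop :=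
  ∃ S : Finset ℝ, IsC1Off E γ S

/-- Horizontal paths: piecewise `C¹`, with velocity annihilated by `α` off the break points. -/
def IsHorizontal (α : LieForm EG EP G P) {x y : P} (c : Path x y) : Prop :=
  ∃ S : Finset ℝ, IsC1Off EP c S ∧ ∀ t ∈ Ioo (0 : ℝ) 1, t ∉ S →
    α (c.extend t) (mfderiv 𝓘(ℝ, ℝ) 𝓘(ℝ, EP) c.extend t (1 : ℝ)) = 0

/-- `c` is a horizontal lift of the path `γ` of the base. -/
def IsHorizontalLift (p : P → M) (α : LieForm EG EP G P) {a b : M} (γ : Path a b)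
    {x y : P} (c : Path x y) : Prop :=
  IsHorizontal EG EP α c ∧ ∀ t, p (c t) = γ t

/-- `h : π₁(M, m) → G` is the holonomy homomorphism of `α` with reference point `x` (over `m`):
every piecewise `C¹` loop `γ` at `m` has a horizontal lift starting at `x`, and each such lift
ends at `h[γ] • x`. -/
def IsHolonomyHom (p : P → M) (α : LieForm EG EP G P) (x : P) (m : M)
    (h : PiOne M m →* G) : Prop :=
  ∀ γ : Path m m, IsPiecewiseC1 EM γ →
    (∃ (y : P) (c : Path x y), IsHorizontalLift EG EP p α γ c) ∧
    ∀ (y : P) (c : Path x y), IsHorizontalLift EG EP p α γ c → y = h (loopClass γ) • x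

/-- The holonomy group of `α` with reference point `x` (as a subset of `G`): all `g` such that `x`
and `g • x` are joined by a horizontal path. -/
def holonomyGroup (α : LieForm EG EP G P) (x : P) : Set G :=
  {g | ∃ c : Path x (g • x), IsHorizontal EG EP α c}

/-! ### Coverings and the induced bundle -/

/-- `q : M' → M` is a regular smooth covering: a covering map and local diffeomorphism for which
the image of the fundamental group of `M'` is a normal subgroup. -/
structure IsRegularCovering {M' : Type*} [TopologicalSpace M'] [ChartedSpace EM M']
    (q : M' → M) : Prop where
  covering : IsCoveringMap q
  localDiffeo : IsLocalDiffeomorph 𝓘(ℝ, EM) 𝓘(ℝ, EM) ∞ q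
  normal : ∀ m' : M', (piOneMap ⟨q, covering.continuous⟩ m').range.Normal

end Principal

section Induced

variable {EM EG EP : Type*}
  [NormedAddCommGroup EM] [NormedSpace ℝ EM]
  [NormedAddCommGroup EG] [NormedSpace ℝ EG]
  [NormedAddCommGroup EP] [NormedSpace ℝ EP]
  {G : Type*} [TopologicalSpace G] [ChartedSpace EG G] [Group G]
  {M M' P : Type*} [TopologicalSpace M] [ChartedSpace EM M]
  [TopologicalSpace M'] [ChartedSpace EM M']
  [TopologicalSpace P] [ChartedSpace EP P] [MulAction G P]
  {q : M' → M} {p : P → M}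

/-- A covering as a continuous map. -/
def IsRegularCovering.toContinuousMap (hq : IsRegularCovering EM q) : C(M', M) :=
  ⟨q, hq.covering.continuous⟩

/-- The total space of the bundle induced by `q` from `p`: pairs `(m', x)` with `q m' = p x`. -/
structure InducedBundle (hq : IsRegularCovering EM q) (hp : IsPrincipalBundle EM EG EP G p) where
  /-- The projection of the induced bundle to `M'`. -/
  proj : M'
  /-- The canonical map from the induced bundle to the original one. -/
  toTotal : P
  comm : q proj = p toTotal

namespace InducedBundle

variable {hq : IsRegularCovering EM q} {hp : IsPrincipalBundle EM EG EP G p}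

@[ext] theorem ext' {z w : InducedBundle hq hp} (h1 : z.proj = w.proj)
    (h2 : z.toTotal = w.toTotal) : z = w := by
  cases z; cases w; cases h1; cases h2; rfl

/-- The topology of a subspace of the product `M' × P`. -/
instance : TopologicalSpace (InducedBundle hq hp) :=
  TopologicalSpace.induced (fun z => (z.proj, z.toTotal)) inferInstance

theorem isInducing : Topology.IsInducing
    (fun z : InducedBundle hq hp => (z.proj, z.toTotal)) := ⟨rfl⟩

/-- The action of `G` on the second component. -/
instance : MulAction G (InducedBundle hq hp) where
  smul g z := ⟨z.proj, g • z.toTotal, z.comm.trans (hp.proj_smul g z.toTotal).symm⟩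
  one_smul z := ext' rfl (one_smul G z.toTotal)
  mul_smul g h z := ext' rfl (mul_smul g h z.toTotal)

theorem continuous_proj : Continuous (proj : InducedBundle hq hp → M') :=
  continuous_fst.comp isInducing.continuous

theorem continuous_toTotal : Continuous (toTotal : InducedBundle hq hp → P) :=
  continuous_snd.comp isInducing.continuous

/-- Since `q` is a local homeomorphism, so is the map from the induced bundle to `P`. -/
theorem isLocalHomeomorph_toTotal :
    IsLocalHomeomorph (toTotal : InducedBundle hq hp → P) := by
  refine IsLocalHomeomorph.mk _ fun z => ?_
  obtain ⟨e, hz, he⟩ := hq.covering.isLocalHomeomorph z.proj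
  have hpc : Continuous p := hp.smooth_proj.continuous
  classical
  have hmem : ∀ x : P, p x ∈ e.target → q (e.symm (p x)) = p x := fun x hx => by
    rw [he]; exact e.right_inv hx
  have hcomm : ∀ w : InducedBundle hq hp, e w.proj = p w.toTotal := fun w => by
    rw [← he]; exact w.comm
  refine ⟨
    { toFun := toTotal
      invFun := fun x => if hx : p x ∈ e.target then ⟨e.symm (p x), x, hmem x hx⟩ else z
      source := proj ⁻¹' e.source
      target := p ⁻¹' e.target
      map_source' := ?_
      map_target' := ?_
      left_inv' := ?_
      right_inv' := ?_
      open_source := e.open_source.preimage continuous_proj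
      open_target := e.open_target.preimage hpc
      continuousOn_toFun := continuous_toTotal.continuousOn
      continuousOn_invFun := ?_ }, hz, fun _ _ => rfl⟩
  · intro w hw
    change p w.toTotal ∈ e.target
    rw [← hcomm]
    exact e.map_source hw
  · intro x hx
    have hx' : p x ∈ e.target := hx
    simp only [dif_pos hx']
    exact e.map_target hx'
  · intro w hw
    have hx' : p w.toTotal ∈ e.target := hcomm w ▸ e.map_source hw
    simp only [dif_pos hx']
    refine ext' ?_ rfl
    change e.symm (p w.toTotal) = w.proj
    rw [← hcomm]
    exact e.left_inv hw
  · intro x hx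
    have hx' : p x ∈ e.target := hx
    simp only [dif_pos hx']
  · rw [isInducing.continuousOn_iff]
    have : ContinuousOn (fun x : P => (e.symm (p x), x)) (p ⁻¹' e.target) :=
      (e.continuousOn_symm.comp hpc.continuousOn (fun _ hx => hx)).prodMk continuousOn_id
    refine this.congr fun x hx => ?_
    have hx' : p x ∈ e.target := hx
    simp only [Function.comp, dif_pos hx']

/-- A local inverse branch of the map to `P`, followed by a chart of `P`. -/
def chart (z : InducedBundle hq hp) : OpenPartialHomeomorph (InducedBundle hq hp) EP :=
  (isLocalHomeomorph_toTotal z).choose.trans (chartAt EP z.toTotal)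

/-- The smooth structure of the induced bundle: its charts are the charts of `P` composed with
restrictions of the local homeomorphism to `P`. -/
instance : ChartedSpace EP (InducedBundle hq hp) where
  atlas := range chart
  chartAt := chart
  mem_chart_source z := by
    have h := (isLocalHomeomorph_toTotal z).choose_spec
    refine ⟨h.1, ?_⟩
    have h2 : (isLocalHomeomorph_toTotal z).choose z = z.toTotal :=
      (congrFun h.2 z).symm
    change (isLocalHomeomorph_toTotal z).choose z ∈ (chartAt EP z.toTotal).source
    rw [h2]
    exact mem_chart_source EP _
  chart_mem_atlas z := mem_range_self z

instance [IsManifold 𝓘(ℝ, EP) ∞ P] : IsManifold 𝓘(ℝ, EP) ∞ (InducedBundle hq hp) := by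
  refine isManifold_of_contDiffOn _ _ _ ?_
  rintro _ _ ⟨z, rfl⟩ ⟨w, rfl⟩
  set L := (isLocalHomeomorph_toTotal z).choose with hL
  set L' := (isLocalHomeomorph_toTotal w).choose with hL'
  have hLe : (toTotal : InducedBundle hq hp → P) = L := (isLocalHomeomorph_toTotal z).choose_spec.2
  have hLe' : (toTotal : InducedBundle hq hp → P) = L' := (isLocalHomeomorph_toTotal w).choose_spec.2
  set c := chartAt EP z.toTotal
  set c' := chartAt EP w.toTotal
  have key : ∀ y ∈ ((chart z).symm.trans (chart w)).source,
      y ∈ (c.symm.trans c').source ∧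
        ((chart z).symm.trans (chart w)) y = (c.symm.trans c') y := by
    intro y hy
    have h1 : y ∈ c.target ∧ c.symm y ∈ L.target := hy.1
    have h2 : L.symm (c.symm y) ∈ L'.source ∧ L' (L.symm (c.symm y)) ∈ c'.source := hy.2
    have h3 : L' (L.symm (c.symm y)) = c.symm y := by
      rw [← hLe', hLe]; exact L.right_inv h1.2
    rw [h3] at h2
    refine ⟨⟨h1.1, h2.2⟩, ?_⟩
    change c' (L' (L.symm (c.symm y))) = c' (c.symm y)
    rw [h3]
  have hc : ContDiffOn ℝ ∞ (c.symm.trans c') (c.symm.trans c').source := by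
    have h := (contDiffGroupoid ∞ 𝓘(ℝ, EP)).compatible (chart_mem_atlas EP z.toTotal)
      (chart_mem_atlas EP w.toTotal)
    have h' := (contDiffGroupoid ∞ 𝓘(ℝ, EP)).mem_of_eqOnSource h (Setoid.refl _)
    rw [contDiffGroupoid, mem_groupoid_of_pregroupoid] at h'
    simpa [contDiffPregroupoid] using h'.1
  simp only [modelWithCornersSelf_coe, modelWithCornersSelf_coe_symm, range_id, inter_univ,
    preimage_id, Function.comp_id, Function.id_comp]
  exact (hc.mono fun y hy => (key y hy).1).congr fun y hy => (key y hy).2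

/-- The connection induced by `q`: the pull-back of `α` under the canonical map to `P`. -/
def inducedForm (hq : IsRegularCovering EM q) (hp : IsPrincipalBundle EM EG EP G p)
    (α : LieForm EG EP G P) : LieForm EG EP G (InducedBundle hq hp) :=
  fun z => (α z.toTotal).comp (mfderiv 𝓘(ℝ, EP) 𝓘(ℝ, EP) (toTotal : InducedBundle hq hp → P) z)

end InducedBundle

end Induced

end FlatCovering

end

/-! The form `α` is flat, so `P → M` has an atlas of trivializations in which the horizontal curves
are exactly those with locally constant component in `G`. Two such trivializations differ by a
locally constant function (`isLocallyConstantAtlas_flatAtlas`), because the section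
`m ↦ e⁻¹(m, g)` is horizontal and so has vanishing derivative in the fibre direction of any other
flat trivialization. Hence `P` carries a finer topology, the leaf topology (`LeafSpace`), in which
small pieces of these sections are open, and with this topology `P → M` is a covering on which the
discrete group `G` acts simply transitively in the fibres (`isQuotientCoveringMap`).

A lift of a piecewise `C¹` path is horizontal if and only if it is continuous for the leaf topology
(`IsHorizontal.continuous_leafSpace`, `isHorizontal_of_continuous_leafSpace`). The theory of
covering spaces therefore provides horizontal lifts, their uniqueness and the homotopy invariance
of their end points, and the holonomy homomorphism is the monodromy of the leaf covering
(`exists_isHolonomyHom`). It is unique, and its image is the holonomy group, because every homotopy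
class of paths in a manifold contains a piecewise `C¹` path (`exists_isPiecewiseC1_homotopic`).

The induced bundle maps to `P` by a local diffeomorphism, and a trivialization of `P` over `U`
induces one of the induced bundle over `q⁻¹(U)`, flat if the original one is. So the above applies
to the induced bundle too. A horizontal lift of `γ` to it projects to a horizontal lift of `q ∘ γ`
to `P`, whence `h' = h ∘ q_#` (`holonomyHom_eq_comp`), and the equality of the images follows. -/

namespace FlatCovering

open Filter Topology

/-! ### The leaf topology of a locally constant family of trivializations -/

section Leaf

variable {G M P : Type*} [TopologicalSpace G] [Group G] [TopologicalSpace M] [TopologicalSpace P]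
  [MulAction G P] {p : P → M}

/-- A family of equivariant local trivializations of `p` whose domains cover the base and whose
horizontal sections `m ↦ e⁻¹(m, g)` agree locally whenever they meet: an atlas of `p` with
locally constant transition functions. -/
structure IsLocallyConstantAtlas (T : Set (Trivialization G p)) : Prop where
  proj_smul : ∀ (g : G) (x : P), p (g • x) = p x
  exists_mem : ∀ m : M, ∃ e ∈ T, m ∈ e.baseSet
  equivariant : ∀ e ∈ T, ∀ (g : G), ∀ x ∈ e.source, e (g • x) = ((e x).1, g * (e x).2)
  eventually_eq : ∀ e ∈ T, ∀ e' ∈ T, ∀ x ∈ e.source, x ∈ e'.source → ∀ᶠ m in 𝓝 (p x),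
    e'.toOpenPartialHomeomorph.symm (m, (e' x).2) = e.toOpenPartialHomeomorph.symm (m, (e x).2)

/-- The total space `P` with the leaf topology of the family `T`. It is a type synonym, so that it
does not carry the given topology of `P`. -/
def LeafSpace (_T : Set (Trivialization G p)) : Type _ := P

variable {T : Set (Trivialization G p)}

instance : MulAction G (LeafSpace T) := inferInstanceAs (MulAction G P)

/-- The leaf topology: a set is open if with each point it contains a piece of the horizontal
section through that point. -/
instance : TopologicalSpace (LeafSpace T) where
  IsOpen O := ∀ e ∈ T, ∀ x ∈ e.source, x ∈ (O : Set P) → ∀ᶠ m in 𝓝 (p x),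
    e.toOpenPartialHomeomorph.symm (m, (e x).2) ∈ (O : Set P)
  isOpen_univ := fun _ _ _ _ _ => Eventually.of_forall fun _ => mem_univ _
  isOpen_inter := fun _ _ h h' e he x hx hxO =>
    (h e he x hx hxO.1).and (h' e he x hx hxO.2)
  isOpen_sUnion := fun S h e he x hx hxO => by
    obtain ⟨O, hO, hxO⟩ := hxO
    exact (h O hO e he x hx hxO).mono fun m hm => ⟨O, hO, hm⟩

/-- The projection of the leaf space. -/
def leafProj (T : Set (Trivialization G p)) : LeafSpace T → M := p

/-- The identity map from `P` to the leaf space. -/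
def toLeaf (T : Set (Trivialization G p)) : P → LeafSpace T := fun x => x

/-- The identity map from the leaf space to `P`. -/
def leafToTotal (T : Set (Trivialization G p)) : LeafSpace T → P := fun x => x

omit [Group G] [MulAction G P] in
theorem symm_mk_snd_eq {e : Trivialization G p} {x y : P} (hy : y ∈ e.source)
    (h : (e y).2 = (e x).2) : e.toOpenPartialHomeomorph.symm (p y, (e x).2) = y := by
  rw [← h]
  exact e.symm_apply_mk_proj hy

namespace IsLocallyConstantAtlas

variable (hT : IsLocallyConstantAtlas T)
include hT

/-- The sheets of an atlas trivialization are open. This is where the local constancy of the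
transition functions enters. -/
theorem isOpen_sheet {e : Trivialization G p} (he : e ∈ T) (g : G) :
    IsOpen ({y | y ∈ e.source ∧ (e y).2 = g} : Set (LeafSpace T)) := by
  rintro e' he' y hy' ⟨hy, rfl⟩
  have hb : p y ∈ e.baseSet := e.mem_source.1 hy
  filter_upwards [hT.eventually_eq e he e' he' y hy hy', e.open_baseSet.mem_nhds hb] with m hm hmb
  rw [hm]
  have : (m, (e y).2) ∈ e.target := e.mem_target.2 hmb
  exact ⟨e.toOpenPartialHomeomorph.map_target this, by
    rw [show e _ = _ from e.toOpenPartialHomeomorph.right_inv this]⟩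

omit [Group G] [MulAction G P] hT in
/-- A map into the leaf space is continuous as soon as its projection is and its fibre component
in a trivialization of the atlas is locally constant. -/
theorem continuousAt_of_eventually {A : Type*} [TopologicalSpace A] {f : A → LeafSpace T} {a : A}
    {e : Trivialization G p} (he : e ∈ T) (ha : (f a : P) ∈ e.source)
    (hp : ContinuousAt (fun b => p (f b)) a)
    (h : ∀ᶠ b in 𝓝 a, (e (f b : P)).2 = (e (f a : P)).2) : ContinuousAt f a := by
  intro s hs
  obtain ⟨O, hOs, hO, haO⟩ := mem_nhds_iff.1 hs
  have hb : p (f a) ∈ e.baseSet := e.mem_source.1 ha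
  change f ⁻¹' s ∈ 𝓝 a
  filter_upwards [h, hp.eventually (hO e he _ ha haO),
    hp.eventually_mem (e.open_baseSet.mem_nhds hb)] with b h1 h2 h3
  rw [symm_mk_snd_eq (e.mem_source.2 h3) h1] at h2
  exact hOs h2

theorem eventually_of_continuousAt {A : Type*} [TopologicalSpace A] {f : A → LeafSpace T} {a : A}
    {e : Trivialization G p} (he : e ∈ T) (ha : (f a : P) ∈ e.source) (hf : ContinuousAt f a) :
    ∀ᶠ b in 𝓝 a, (f b : P) ∈ e.source ∧ (e (f b : P)).2 = (e (f a : P)).2 :=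
  hf.eventually ((hT.isOpen_sheet he _).mem_nhds ⟨ha, rfl⟩)

omit [Group G] [MulAction G P] hT in
theorem continuous_leafProj : Continuous (leafProj T) := by
  refine ⟨fun V hV e he x hx hxV => ?_⟩
  have hb : p x ∈ e.baseSet := e.mem_source.1 hx
  filter_upwards [hV.mem_nhds hxV, e.open_baseSet.mem_nhds hb] with m hm hmb
  change p _ ∈ V
  rwa [e.proj_symm_apply' hmb]

theorem isOpenMap_leafProj : IsOpenMap (leafProj T) := by
  intro O hO
  rw [isOpen_iff_mem_nhds]
  rintro _ ⟨x, hx, rfl⟩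
  obtain ⟨e, he, hb⟩ := hT.exists_mem (p x)
  have hb' : p x ∈ e.baseSet := hb
  filter_upwards [hO e he x (e.mem_source.2 hb) hx, e.open_baseSet.mem_nhds hb'] with m hm hmb
  exact ⟨_, hm, e.proj_symm_apply' hmb⟩

omit [Group G] [MulAction G P] hT in
/-- The leaf topology is finer than the topology of `P`. -/
theorem continuous_leafToTotal : Continuous (leafToTotal T) := by
  refine ⟨fun O hO e he x hx hxO => ?_⟩
  have hb : p x ∈ e.baseSet := e.mem_source.1 hx
  have hc : ContinuousAt (fun m => e.toOpenPartialHomeomorph.symm (m, (e x).2)) (p x) := by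
    refine ContinuousAt.comp (f := fun m : M => (m, (e x).2))
      (e.toOpenPartialHomeomorph.symm.continuousAt ?_) (by fun_prop)
    exact e.mem_target.2 hb
  refine hc.eventually_mem (hO.mem_nhds ?_)
  rw [symm_mk_snd_eq hx rfl]
  exact hxO

theorem apply_smul_symm {e : Trivialization G p} (he : e ∈ T) (g h : G) {m : M}
    (hm : m ∈ e.baseSet) : g • e.toOpenPartialHomeomorph.symm (m, h) =
      e.toOpenPartialHomeomorph.symm (m, g * h) := by
  have ht : (m, h) ∈ e.target := e.mem_target.2 hm
  have hs := e.toOpenPartialHomeomorph.map_target ht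
  have hp : p (e.toOpenPartialHomeomorph.symm (m, h)) = m := e.proj_symm_apply' hm
  have hs' : g • e.toOpenPartialHomeomorph.symm (m, h) ∈ e.source := by
    rw [e.mem_source, hT.proj_smul, hp]; exact hm
  apply e.injOn hs' (e.toOpenPartialHomeomorph.map_target (e.mem_target.2 hm))
  change e _ = e _
  rw [hT.equivariant e he g _ hs, show e _ = _ from e.toOpenPartialHomeomorph.right_inv ht,
    show e _ = _ from e.toOpenPartialHomeomorph.right_inv (e.mem_target.2 hm)]

theorem exists_smul_eq {x y : P} (h : p x = p y) : ∃ g : G, g • y = x := by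
  obtain ⟨e, he, hb⟩ := hT.exists_mem (p x)
  have hx : x ∈ e.source := e.mem_source.2 hb
  have hy : y ∈ e.source := e.mem_source.2 (h ▸ hb)
  refine ⟨(e x).2 * (e y).2⁻¹, e.injOn (e.mem_source.2 ?_) hx ?_⟩
  · rw [hT.proj_smul, ← h]; exact hb
  · change e _ = e _
    rw [hT.equivariant e he _ y hy, inv_mul_cancel_right, e.coe_fst hy, ← h, ← e.coe_fst hx]

/-- With the leaf topology, `P → M` is a covering with the discrete group `G` as deck group. -/
theorem isQuotientCoveringMap (hsurj : Function.Surjective p) :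
    IsQuotientCoveringMap (leafProj T) G where
  toIsQuotientMap := hT.isOpenMap_leafProj.isQuotientMap continuous_leafProj hsurj
  continuous_const_smul g := by
    refine ⟨fun O hO e he x hx hxO => ?_⟩
    have hb : p x ∈ e.baseSet := e.mem_source.1 hx
    have hgx : (g • x : P) ∈ e.source := by rw [e.mem_source, hT.proj_smul]; exact hb
    have h := hO e he (g • x) hgx hxO
    rw [hT.proj_smul] at h
    filter_upwards [h, e.open_baseSet.mem_nhds hb] with m hm hmb
    change g • e.toOpenPartialHomeomorph.symm (m, (e x).2) ∈ O
    rw [hT.apply_smul_symm he _ _ hmb]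
    simpa only [hT.equivariant e he g x hx] using hm
  apply_eq_iff_mem_orbit {x y} :=
    ⟨fun h => hT.exists_smul_eq h, fun ⟨g, hg⟩ => by rw [← hg]; exact hT.proj_smul g y⟩
  disjoint x := by
    obtain ⟨e, he, hb⟩ := hT.exists_mem (p x)
    refine ⟨_, (hT.isOpen_sheet he (e x).2).mem_nhds ⟨e.mem_source.2 hb, rfl⟩, ?_⟩
    rintro g ⟨_, ⟨y, ⟨hy, hyx⟩, rfl⟩, _, hz⟩
    have hz' : (e (g • y : P)).2 = (e x).2 := hz
    have hg : (e (g • y : P)).2 = g * (e y).2 := congrArg Prod.snd (hT.equivariant e he g y hy)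
    exact mul_eq_right.1 ((hyx ▸ hg).symm.trans hz')

theorem surjective_proj : Function.Surjective p := fun m => by
  obtain ⟨e, -, hb⟩ := hT.exists_mem m
  exact ⟨_, e.proj_symm_apply' (b := m) (x := 1) hb⟩

/-- The monodromy of the leaf covering is a homomorphism from `π₁(M, m)` to `G`: the lift of `γ`
to the leaf space that starts at `x` ends at `h[γ] • x`. Monodromy commutes with the left action
of `G`, so it reverses Mathlib's order of multiplication of loops, which is why `PiOne` uses the
opposite group. -/
theorem exists_monodromyHom {x : P} {m : M} (hx : p x = m) :
    ∃ h : PiOne M m →* G, ∀ γ : Path m m,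
      (∃ c : C(unitInterval, LeafSpace T), c 0 = x ∧ ∀ t, leafProj T (c t) = γ t) ∧
      ∀ c : C(unitInterval, LeafSpace T), c 0 = x → (∀ t, leafProj T (c t) = γ t) →
        c 1 = h (loopClass γ) • (x : LeafSpace T) := by
  have hq := hT.isQuotientCoveringMap hT.surjective_proj
  let x₀ : leafProj T ⁻¹' {m} := ⟨x, hx⟩
  let φ := hq.fundamentalGroupToMulOpposite x₀
  refine ⟨{ toFun := fun a => (φ a.unop).unop, map_one' := ?_, map_mul' := fun a b => ?_ },
    fun γ => ?_⟩
  · rw [MulOpposite.unop_one, map_one, MulOpposite.unop_one]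
  · rw [MulOpposite.unop_mul, map_mul, MulOpposite.unop_mul]
  have h0 : γ 0 = leafProj T x₀ := γ.source.trans hx.symm
  have hlift := hq.isCoveringMap.liftPath_lifts γ x₀ h0
  refine ⟨⟨hq.isCoveringMap.liftPath γ x₀ h0, hq.isCoveringMap.liftPath_zero γ x₀ h0,
    fun t => congrFun hlift t⟩, fun c hc0 hc => ?_⟩
  have hc' := (hq.isCoveringMap.eq_liftPath_iff' h0).2 ⟨funext hc, hc0⟩
  rw [hc']
  exact (hq.unop_fundamentalGroupToMulOpposite_smul (e := x₀)
    (γ := FundamentalGroup.fromPath (Path.Homotopic.Quotient.mk γ))).symm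

end IsLocallyConstantAtlas

end Leaf

/-! ### Maps with vanishing derivative -/

section ZeroDerivative

variable {E F : Type*} [NormedAddCommGroup E] [NormedSpace ℝ E] [NormedAddCommGroup F]
  [NormedSpace ℝ F] {N X : Type*} [TopologicalSpace N] [ChartedSpace E N]
  [TopologicalSpace X] [ChartedSpace F X]

/-- A map between manifolds with vanishing derivative near `x` is constant near `x`. -/
theorem eventually_eq_of_mfderiv_eq_zero [IsManifold 𝓘(ℝ, E) ∞ N] [IsManifold 𝓘(ℝ, F) ∞ X]
    {f : N → X} {x : N}
    (h : ∀ᶠ y in 𝓝 x, MDifferentiableAt 𝓘(ℝ, E) 𝓘(ℝ, F) f y ∧ mfderiv 𝓘(ℝ, E) 𝓘(ℝ, F) f y = 0) :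
    ∀ᶠ y in 𝓝 x, f y = f x := by
  have : IsManifold 𝓘(ℝ, E) 1 N := .of_le (n := ∞) (by simp)
  have : IsManifold 𝓘(ℝ, F) 1 X := .of_le (n := ∞) (by simp)
  set φ := extChartAt 𝓘(ℝ, E) x with hφ
  set ψ := extChartAt 𝓘(ℝ, F) (f x) with hψ
  have hfx : ContinuousAt f x := h.self_of_nhds.1.continuousAt
  have hgood : ∀ᶠ y in 𝓝 x, (MDifferentiableAt 𝓘(ℝ, E) 𝓘(ℝ, F) f y ∧
      mfderiv 𝓘(ℝ, E) 𝓘(ℝ, F) f y = 0) ∧ f y ∈ ψ.source :=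
    h.and (hfx.eventually_mem (extChartAt_source_mem_nhds (I := 𝓘(ℝ, F)) (f x)))
  have hsymm : Tendsto φ.symm (𝓝 (φ x)) (𝓝 x) := by
    have := continuousAt_extChartAt_symm (I := 𝓘(ℝ, E)) x
    rwa [ContinuousAt, extChartAt_to_inv] at this
  have hev : ∀ᶠ z in 𝓝 (φ x), z ∈ φ.target ∧ (MDifferentiableAt 𝓘(ℝ, E) 𝓘(ℝ, F) f (φ.symm z) ∧
      mfderiv 𝓘(ℝ, E) 𝓘(ℝ, F) f (φ.symm z) = 0) ∧ f (φ.symm z) ∈ ψ.source :=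
    Filter.Eventually.and (extChartAt_target_mem_nhds (I := 𝓘(ℝ, E)) x) (hsymm.eventually hgood)
  obtain ⟨r, hr, hball⟩ := Metric.eventually_nhds_iff_ball.1 hev
  have hd : ∀ z ∈ Metric.ball (φ x) r,
      HasFDerivAt (fun z => ψ (f (φ.symm z))) (0 : E →L[ℝ] F) z := by
    intro z hz
    obtain ⟨hzt, ⟨hz1, hz2⟩, hz3⟩ := hball z hz
    have h1 : HasMFDerivAt 𝓘(ℝ, E) 𝓘(ℝ, F) f (φ.symm z) 0 := hz2 ▸ hz1.hasMFDerivAt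
    have h2 : MDifferentiableAt 𝓘(ℝ, E) 𝓘(ℝ, E) φ.symm z :=
      (mdifferentiableOn_extChartAt_symm (I := 𝓘(ℝ, E)) z hzt).mdifferentiableAt
        ((isOpen_extChartAt_target x).mem_nhds hzt)
    have h3 : MDifferentiableAt 𝓘(ℝ, F) 𝓘(ℝ, F) ψ (f (φ.symm z)) :=
      mdifferentiableAt_extChartAt (by simpa [hψ] using hz3)
    have h4 := h3.hasMFDerivAt.comp z (h1.comp z h2.hasMFDerivAt)
    exact HasFDerivAt.congr_fderiv h4.hasFDerivAt (ContinuousLinearMap.ext fun v =>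
      map_zero (mfderiv 𝓘(ℝ, F) 𝓘(ℝ, F) ψ (f (φ.symm z))))
  have hconst : ∀ z ∈ Metric.ball (φ x) r, ψ (f (φ.symm z)) = ψ (f x) := by
    intro z hz
    have := (convex_ball (φ x) r).is_const_of_fderivWithin_eq_zero (𝕜 := ℝ)
      (f := fun z => ψ (f (φ.symm z)))
      (fun z hz => (hd z hz).differentiableAt.differentiableWithinAt)
      (fun z hz => (hd z hz).hasFDerivWithinAt.fderivWithin
        (Metric.isOpen_ball.uniqueDiffWithinAt hz)) hz (Metric.mem_ball_self hr)
    simpa only [hφ, extChartAt_to_inv] using this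
  have hφc : ContinuousAt φ x := continuousAt_extChartAt (I := 𝓘(ℝ, E)) x
  filter_upwards [hφc.eventually_mem (Metric.ball_mem_nhds _ hr), hgood,
    extChartAt_source_mem_nhds (I := 𝓘(ℝ, E)) x] with y hy1 hy2 hy3
  have := hconst _ hy1
  rw [φ.left_inv hy3] at this
  exact ψ.injOn hy2.2 (mem_extChartAt_source (I := 𝓘(ℝ, F)) (f x)) this

/-- A continuous curve whose velocity vanishes off a finite set is locally constant. -/
theorem eventually_eq_of_mfderiv_eq_zero_off_finset [FiniteDimensional ℝ F]
    [IsManifold 𝓘(ℝ, F) ∞ X] {f : ℝ → X} {t : ℝ} {S : Finset ℝ}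
    (hc : ∀ᶠ s in 𝓝 t, ContinuousAt f s)
    (h : ∀ᶠ s in 𝓝 t, s ∉ S → MDifferentiableAt 𝓘(ℝ, ℝ) 𝓘(ℝ, F) f s ∧
      mfderiv 𝓘(ℝ, ℝ) 𝓘(ℝ, F) f s (1 : ℝ) = 0) :
    ∀ᶠ s in 𝓝 t, f s = f t := by
  have : IsManifold 𝓘(ℝ, F) 1 X := .of_le (n := ∞) (by simp)
  have : CompleteSpace F := FiniteDimensional.complete ℝ F
  set ψ := extChartAt 𝓘(ℝ, F) (f t) with hψ
  have hev := (hc.self_of_nhds.eventually_mem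
    (extChartAt_source_mem_nhds (I := 𝓘(ℝ, F)) (f t))).and (hc.and h)
  obtain ⟨r, hr, hball⟩ := Metric.eventually_nhds_iff_ball.1 hev
  have hcont : ContinuousOn (fun s => ψ (f s)) (Metric.ball t r) := fun s hs =>
    ((continuousAt_extChartAt' (hball s hs).1).comp (hball s hs).2.1).continuousWithinAt
  have hderiv : ∀ s ∈ Metric.ball t r, s ∉ S → HasDerivAt (fun s => ψ (f s)) 0 s := by
    intro s hs hsS
    obtain ⟨h1, -, h2⟩ := hball s hs
    obtain ⟨h2, h3⟩ := h2 hsS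
    have h4 : MDifferentiableAt 𝓘(ℝ, F) 𝓘(ℝ, F) ψ (f s) :=
      mdifferentiableAt_extChartAt (by simpa [hψ] using h1)
    have h5 : HasFDerivAt (fun s => ψ (f s)) (_ : ℝ →L[ℝ] F) s :=
      (h4.hasMFDerivAt.comp s h2.hasMFDerivAt).hasFDerivAt
    refine HasDerivAt.congr_deriv h5.hasDerivAt ?_
    exact (congrArg (mfderiv 𝓘(ℝ, F) 𝓘(ℝ, F) ψ (f s)) h3).trans (map_zero _)
  have key : ∀ a ∈ Metric.ball t r, ∀ b ∈ Metric.ball t r, a ≤ b → ψ (f b) = ψ (f a) := by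
    intro a ha b hb hab
    have hsub : Icc a b ⊆ Metric.ball t r := (convex_ball t r).ordConnected.out ha hb
    -- The fundamental theorem of calculus tolerates countably many exceptional points.
    have := MeasureTheory.integral_eq_of_hasDerivAt_off_countable_of_le (fun s => ψ (f s))
      (fun _ => (0 : F)) hab (s := (S : Set ℝ)) S.countable_toSet (hcont.mono hsub)
      (fun s hs => hderiv s (hsub (Ioo_subset_Icc_self hs.1)) hs.2)
      (by simp)
    rw [intervalIntegral.integral_zero] at this
    exact sub_eq_zero.1 this.symm
  filter_upwards [Metric.ball_mem_nhds t hr] with s hs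
  refine ψ.injOn (hball s hs).1 (mem_extChartAt_source (I := 𝓘(ℝ, F)) (f t)) ?_
  rcases le_total t s with h | h
  · exact key t (Metric.mem_ball_self hr) s hs h
  · exact (key s hs t (Metric.mem_ball_self hr) h).symm

end ZeroDerivative

/-! ### Flat trivializations and horizontal curves -/

section Flat

variable {EM EG EP : Type*}
  [NormedAddCommGroup EM] [NormedSpace ℝ EM]
  [NormedAddCommGroup EG] [NormedSpace ℝ EG]
  [NormedAddCommGroup EP] [NormedSpace ℝ EP]
  {G : Type*} [TopologicalSpace G] [ChartedSpace EG G] [Group G]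
  {M P : Type*} [TopologicalSpace M] [ChartedSpace EM M]
  [TopologicalSpace P] [ChartedSpace EP P] [MulAction G P] {p : P → M} {α : LieForm EG EP G P}

/-- The Maurer-Cartan form is injective, since right translation by `a⁻¹` is invertible. -/
theorem eq_zero_of_maurerCartan_eq_zero [LieGroup 𝓘(ℝ, EG) ∞ G] {a : G}
    {v : TangentSpace 𝓘(ℝ, EG) a} (h : maurerCartan EG a v = 0) : v = 0 := by
  have hr : ∀ b : G, MDifferentiable 𝓘(ℝ, EG) 𝓘(ℝ, EG) (fun h : G => h * b) := fun b =>
    (contMDiff_mul_right (I := 𝓘(ℝ, EG)) (n := ∞) (a := b)).mdifferentiable (by simp)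
  have h1 := (hr a (a * a⁻¹)).hasMFDerivAt.comp a (hr a⁻¹ a).hasMFDerivAt
  have h2 : (fun h : G => h * a) ∘ (fun h : G => h * a⁻¹) = id := by
    ext; simp
  rw [h2] at h1
  have h3 := DFunLike.congr_fun (hasMFDerivAt_unique h1 (hasMFDerivAt_id a)) v
  refine Eq.trans (Eq.symm h3) ?_
  exact (congrArg (mfderiv 𝓘(ℝ, EG) 𝓘(ℝ, EG) (fun h : G => h * a) (a * a⁻¹)) h).trans
    (map_zero _)

variable (EM α) in
/-- A principal trivialization which identifies `α` with the canonical flat connection. -/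
def IsFlatTrivialization (e : Trivialization G p) : Prop :=
  IsPrincipalTrivialization EM EG EP e ∧
    ∀ x ∈ e.source, ∀ v : TangentSpace 𝓘(ℝ, EP) x,
      α x v = maurerCartan EG (e x).2 (mfderiv 𝓘(ℝ, EP) 𝓘(ℝ, EG) (fun y : P => (e y).2) x v)

variable (EM p α) in
/-- The flat trivializations of `p` with respect to `α`. -/
def flatAtlas : Set (Trivialization G p) := {e | IsFlatTrivialization EM α e}

theorem IsPrincipalTrivialization.contMDiffAt_snd {e : Trivialization G p}
    (he : IsPrincipalTrivialization EM EG EP e) {x : P} (hx : x ∈ e.source) :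
    ContMDiffAt 𝓘(ℝ, EP) 𝓘(ℝ, EG) ∞ (fun y => (e y).2) x :=
  (he.smooth.contMDiffAt (e.open_source.mem_nhds hx)).snd

theorem IsPrincipalTrivialization.contMDiffAt_symm {e : Trivialization G p}
    (he : IsPrincipalTrivialization EM EG EP e) (g : G) {m : M} (hm : m ∈ e.baseSet) :
    ContMDiffAt 𝓘(ℝ, EM) 𝓘(ℝ, EP) ∞ (fun m => e.toOpenPartialHomeomorph.symm (m, g)) m :=
  ContMDiffAt.comp m (he.smooth_symm.contMDiffAt (x := (m, g))
      (e.open_target.mem_nhds (e.mem_target.2 hm)))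
    (contMDiffAt_id.prodMk contMDiffAt_const)

/-- The chain rule in a flat trivialization: `α` vanishes on the image of a tangent vector exactly
if the derivative of the fibre component does. -/
theorem IsFlatTrivialization.form_mfderiv_eq_zero_iff [LieGroup 𝓘(ℝ, EG) ∞ G]
    {E : Type*} [NormedAddCommGroup E] [NormedSpace ℝ E] {N : Type*} [TopologicalSpace N]
    [ChartedSpace E N] {e : Trivialization G p} (he : IsFlatTrivialization EM α e) {f : N → P}
    {t : N} (hf : MDifferentiableAt 𝓘(ℝ, E) 𝓘(ℝ, EP) f t) (ht : f t ∈ e.source)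
    (v : TangentSpace 𝓘(ℝ, E) t) :
    α (f t) (mfderiv 𝓘(ℝ, E) 𝓘(ℝ, EP) f t v) = 0 ↔
      mfderiv 𝓘(ℝ, E) 𝓘(ℝ, EG) (fun s => (e (f s)).2) t v = 0 := by
  have hc : mfderiv 𝓘(ℝ, E) 𝓘(ℝ, EG) (fun s => (e (f s)).2) t =
      (mfderiv 𝓘(ℝ, EP) 𝓘(ℝ, EG) (fun y => (e y).2) (f t)).comp
        (mfderiv 𝓘(ℝ, E) 𝓘(ℝ, EP) f t) :=
    mfderiv_comp t ((he.1.contMDiffAt_snd ht).mdifferentiableAt (by simp)) hf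
  rw [he.2 _ ht, hc]
  refine ⟨fun h => eq_zero_of_maurerCartan_eq_zero h, fun h => ?_⟩
  exact (congrArg _ h).trans (map_zero _)

/-- Two flat trivializations differ by a locally constant function with values in `G`, since the
section `m ↦ e⁻¹(m, g)` is horizontal. -/
theorem isLocallyConstantAtlas_flatAtlas [LieGroup 𝓘(ℝ, EG) ∞ G] [IsManifold 𝓘(ℝ, EM) ∞ M]
    (hp : IsPrincipalBundle EM EG EP G p) (hflat : IsFlat EM EG EP p α) :
    IsLocallyConstantAtlas (flatAtlas EM p α) where
  proj_smul := hp.proj_smul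
  exists_mem m := by
    obtain ⟨e, hm, h⟩ := hflat m
    exact ⟨e, h, hm⟩
  equivariant e he := he.1.equivariant
  eventually_eq e he e' he' x hx hx' := by
    set s : M → P := fun m => e.toOpenPartialHomeomorph.symm (m, (e x).2) with hs
    have hb : p x ∈ e.baseSet := e.mem_source.1 hx
    have hb' : p x ∈ e'.baseSet := e'.mem_source.1 hx'
    have hsx : s (p x) = x := symm_mk_snd_eq hx rfl
    have hps : ∀ m ∈ e.baseSet, p (s m) = m := fun m hm => e.proj_symm_apply' hm
    have hnhds := inter_mem (e.open_baseSet.mem_nhds hb) (e'.open_baseSet.mem_nhds hb')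
    have hconst : ∀ᶠ m in 𝓝 (p x), (e' (s m)).2 = (e' (s (p x))).2 := by
      refine eventually_eq_of_mfderiv_eq_zero (E := EM) (F := EG) ?_
      filter_upwards [hnhds] with m hm
      have hsm : MDifferentiableAt 𝓘(ℝ, EM) 𝓘(ℝ, EP) s m :=
        (he.1.contMDiffAt_symm _ hm.1).mdifferentiableAt (by simp)
      have hm1 : s m ∈ e.source := by rw [e.mem_source, hps m hm.1]; exact hm.1
      have hm2 : s m ∈ e'.source := by rw [e'.mem_source, hps m hm.1]; exact hm.2
      refine ⟨MDifferentiableAt.comp (g := fun y => (e' y).2) m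
        ((he'.1.contMDiffAt_snd hm2).mdifferentiableAt (by simp)) hsm, ?_⟩
      ext v
      refine (he'.form_mfderiv_eq_zero_iff hsm hm2 v).1 <|
        (he.form_mfderiv_eq_zero_iff hsm hm1 v).2 ?_
      have : (fun m => (e (s m)).2) =ᶠ[𝓝 m] fun _ => (e x).2 := by
        filter_upwards [e.open_baseSet.mem_nhds hm.1] with m' hm'
        have h : e (s m') = (m', (e x).2) :=
          e.toOpenPartialHomeomorph.right_inv (e.mem_target.2 hm')
        rw [h]
      rw [this.mfderiv_eq, mfderiv_const]
      rfl
    filter_upwards [hconst, hnhds] with m h hm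
    rw [hsx] at h
    have hm2 : s m ∈ e'.source := by rw [e'.mem_source, hps m hm.1]; exact hm.2
    have := symm_mk_snd_eq hm2 h
    rwa [hps m hm.1] at this

/-! ### Horizontal lifts are lifts to the leaf space -/

theorem IsC1Off.contMDiffAt {E X : Type*} [NormedAddCommGroup E] [NormedSpace ℝ E]
    [TopologicalSpace X] [ChartedSpace E X] {a b : X} {γ : Path a b} {S : Finset ℝ}
    (h : IsC1Off E γ S) {t : ℝ} (ht : t ∈ Ioo (0 : ℝ) 1) (htS : t ∉ S) :
    ContMDiffAt 𝓘(ℝ, ℝ) 𝓘(ℝ, E) 1 γ.extend t := by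
  have h1 : (S : Set ℝ)ᶜ ∩ Ioo 0 1 ∈ 𝓝 t :=
    inter_mem (S.finite_toSet.isClosed.isOpen_compl.mem_nhds htS) (isOpen_Ioo.mem_nhds ht)
  obtain ⟨r, hr, hball⟩ := Metric.mem_nhds_iff.1 h1
  have hsub : Icc (t - r / 2) (t + r / 2) ⊆ Metric.ball t r := by
    rw [← Real.closedBall_eq_Icc]
    exact Metric.closedBall_subset_ball (by linarith)
  have hl := (hball (hsub (left_mem_Icc.2 (by linarith)))).2
  have hu := (hball (hsub (right_mem_Icc.2 (by linarith)))).2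
  refine (h (t - r / 2) (t + r / 2) hl.1.le (by linarith) hu.2.le ?_).contMDiffAt
    (Icc_mem_nhds (by linarith) (by linarith))
  rw [Set.disjoint_left]
  exact fun s hs => (hball (hsub (Ioo_subset_Icc_self hs))).1

/-- In a flat trivialization, the fibre component of a horizontal path is locally constant. -/
theorem IsHorizontal.eventually_snd_eq [LieGroup 𝓘(ℝ, EG) ∞ G] [FiniteDimensional ℝ EG]
    {x y : P} {c : Path x y} (hc : IsHorizontal EG EP α c) {e : Trivialization G p}
    (he : IsFlatTrivialization EM α e) {t : ℝ} (ht : c.extend t ∈ e.source) :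
    ∀ᶠ s in 𝓝 t, (e (c.extend s)).2 = (e (c.extend t)).2 := by
  have : IsManifold 𝓘(ℝ, EG) ∞ G := inferInstance
  obtain ⟨S, hS, hS'⟩ := hc
  have hcc : Continuous c.extend := c.continuous_extend
  have hsource := hcc.continuousAt.eventually_mem (e.open_source.mem_nhds ht)
  -- The extension of `c` is constant on either side of `[0, 1]`, so that only the end points have
  -- to be added to the break points.
  refine eventually_eq_of_mfderiv_eq_zero_off_finset (F := EG) (S := S ∪ {0, 1}) ?_ ?_
  · filter_upwards [hsource] with s hs
    exact ContinuousAt.comp (g := fun y => (e y).2)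
      (he.1.contMDiffAt_snd hs).continuousAt hcc.continuousAt
  · filter_upwards [hsource] with s hs hsS
    simp only [Finset.mem_union, Finset.mem_insert, Finset.mem_singleton, not_or] at hsS
    have hlocal : ∀ z : P, c.extend =ᶠ[𝓝 s] (fun _ => z) →
        MDifferentiableAt 𝓘(ℝ, ℝ) 𝓘(ℝ, EG) (fun s => (e (c.extend s)).2) s ∧
        mfderiv 𝓘(ℝ, ℝ) 𝓘(ℝ, EG) (fun s => (e (c.extend s)).2) s (1 : ℝ) = 0 := by
      intro z hz
      have h : (fun s => (e (c.extend s)).2) =ᶠ[𝓝 s] fun _ => (e z).2 :=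
        hz.fun_comp fun y => (e y).2
      refine ⟨mdifferentiableAt_const.congr_of_eventuallyEq h, ?_⟩
      rw [h.mfderiv_eq, mfderiv_const]
      rfl
    rcases lt_or_gt_of_ne hsS.2.1 with h0 | h0
    · refine hlocal x ?_
      filter_upwards [Iio_mem_nhds h0] with u hu using c.extend_of_le_zero hu.le
    rcases lt_or_gt_of_ne hsS.2.2 with h1 | h1
    · have hd := (hS.contMDiffAt ⟨h0, h1⟩ hsS.1).mdifferentiableAt (by simp)
      exact ⟨MDifferentiableAt.comp (g := fun y => (e y).2) s
        ((he.1.contMDiffAt_snd hs).mdifferentiableAt (by simp)) hd,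
        (he.form_mfderiv_eq_zero_iff hd hs (1 : ℝ)).1 (hS' s ⟨h0, h1⟩ hsS.1)⟩
    · refine hlocal y ?_
      filter_upwards [Ioi_mem_nhds h1] with u hu using c.extend_of_one_le hu.le

/-- A horizontal path is continuous for the leaf topology. -/
theorem IsHorizontal.continuous_leafSpace [LieGroup 𝓘(ℝ, EG) ∞ G] [FiniteDimensional ℝ EG]
    (hp : IsPrincipalBundle EM EG EP G p) (hflat : IsFlat EM EG EP p α)
    {x y : P} {c : Path x y} (hc : IsHorizontal EG EP α c) :
    Continuous (fun t => toLeaf (flatAtlas EM p α) (c t)) := by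
  refine continuous_iff_continuousAt.2 fun t => ?_
  obtain ⟨e, hb, he⟩ := hflat (p (c t))
  have hs : c t ∈ e.source := e.mem_source.2 hb
  refine IsLocallyConstantAtlas.continuousAt_of_eventually (T := flatAtlas EM p α) (e := e) he hs
    (hp.smooth_proj.continuous.comp c.continuous).continuousAt ?_
  have h := hc.eventually_snd_eq (c := c) (t := (t : ℝ)) he (by simpa using hs)
  have h' := (continuous_subtype_val.continuousAt (x := t)).eventually h
  simp only [Path.extend_apply, Subtype.coe_prop, Subtype.coe_eta] at h'
  exact h'

/-- A lift of a piecewise `C¹` path to the leaf space is a horizontal lift. -/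
theorem isHorizontal_of_continuous_leafSpace [LieGroup 𝓘(ℝ, EG) ∞ G] [IsManifold 𝓘(ℝ, EM) ∞ M]
    (hp : IsPrincipalBundle EM EG EP G p) (hflat : IsFlat EM EG EP p α)
    {a b : M} {γ : Path a b} (hγ : IsPiecewiseC1 EM γ) {x y : P} {c : Path x y}
    (hc : Continuous (fun t => toLeaf (flatAtlas EM p α) (c t)))
    (hcγ : ∀ t, p (c t) = γ t) : IsHorizontal EG EP α c := by
  have hT := isLocallyConstantAtlas_flatAtlas hp hflat
  have hext : ∀ s, p (c.extend s) = γ.extend s := fun s => hcγ _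
  have hloc : ∀ t : ℝ, ∃ e : Trivialization G p, IsFlatTrivialization EM α e ∧
      c.extend t ∈ e.source ∧ ∀ᶠ s in 𝓝 t, c.extend s ∈ e.source ∧
        (e (c.extend s)).2 = (e (c.extend t)).2 := by
    intro t
    obtain ⟨e, hb, he⟩ := hflat (p (c.extend t))
    have hs : c.extend t ∈ e.source := e.mem_source.2 hb
    refine ⟨e, he, hs, ?_⟩
    exact hT.eventually_of_continuousAt (A := ℝ) (f := fun s => toLeaf _ (c.extend s)) he hs
      (hc.comp continuous_projIcc).continuousAt
  obtain ⟨S, hS⟩ := hγ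
  have hS' : IsC1Off EP c S := by
    intro s u hs hsu hu hd t ht
    obtain ⟨e, he, hts, hev⟩ := hloc t
    have h1 : ContMDiffWithinAt 𝓘(ℝ, ℝ) 𝓘(ℝ, EP) 1
        ((fun m => e.toOpenPartialHomeomorph.symm (m, (e (c.extend t)).2)) ∘ γ.extend)
        (Icc s u) t := by
      refine ContMDiffAt.comp_contMDiffWithinAt t ?_ (hS s u hs hsu hu hd t ht)
      refine (he.1.contMDiffAt_symm _ ?_).of_le (by simp)
      rw [← hext]
      exact e.mem_source.1 hts
    refine h1.congr_of_eventuallyEq (mem_nhdsWithin_of_mem_nhds ?_) ?_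
    · filter_upwards [hev] with v hv
      rw [Function.comp, ← hext]
      exact (symm_mk_snd_eq hv.1 hv.2).symm
    · rw [Function.comp, ← hext]
      exact (symm_mk_snd_eq hts rfl).symm
  refine ⟨S, hS', fun t ht htS => ?_⟩
  obtain ⟨e, he, hts, hev⟩ := hloc t
  refine (he.form_mfderiv_eq_zero_iff ((hS'.contMDiffAt ht htS).mdifferentiableAt (by simp))
    hts (1 : ℝ)).2 ?_
  have h : (fun s => (e (c.extend s)).2) =ᶠ[𝓝 t] fun _ => (e (c.extend t)).2 :=
    hev.mono fun s hs => hs.2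
  rw [h.mfderiv_eq, mfderiv_const]
  rfl

/-- The holonomy homomorphism of a flat connection exists: it is the monodromy of the covering
of `M` by the leaf space. -/
theorem exists_isHolonomyHom [LieGroup 𝓘(ℝ, EG) ∞ G] [FiniteDimensional ℝ EG]
    [IsManifold 𝓘(ℝ, EM) ∞ M] (hp : IsPrincipalBundle EM EG EP G p)
    (hflat : IsFlat EM EG EP p α) {x : P} {m : M} (hx : p x = m) :
    ∃ h : PiOne M m →* G, IsHolonomyHom EM EG EP p α x m h := by
  obtain ⟨h, hh⟩ := (isLocallyConstantAtlas_flatAtlas hp hflat).exists_monodromyHom hx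
  refine ⟨h, fun γ hγ => ?_⟩
  obtain ⟨⟨c, hc0, hc⟩, huniq⟩ := hh γ
  constructor
  · let c' : Path x (c 1) :=
      { toFun := fun t => leafToTotal _ (c t)
        continuous_toFun := IsLocallyConstantAtlas.continuous_leafToTotal.comp c.continuous
        source' := hc0
        target' := rfl }
    exact ⟨c 1, c', isHorizontal_of_continuous_leafSpace hp hflat hγ c.continuous hc, hc⟩
  · intro y c' hc'
    have := huniq ⟨fun t => toLeaf _ (c' t), hc'.1.continuous_leafSpace hp hflat⟩ c'.source hc'.2
    exact c'.target.symm.trans this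

end Flat

/-! ### Piecewise `C¹` representatives of homotopy classes -/

section PiecewiseC1

variable {E : Type*} [NormedAddCommGroup E] [NormedSpace ℝ E] {X : Type*} [TopologicalSpace X]
  [ChartedSpace E X]

theorem homotopic_cast {a b a' b' : X} {γ δ : Path a b} (h : γ.Homotopic δ) (ha : a' = a)
    (hb : b' = b) : (γ.cast ha hb).Homotopic (δ.cast ha hb) := by
  subst ha hb
  exact h

theorem isPiecewiseC1_refl (a : X) : IsPiecewiseC1 E (Path.refl a) := by
  refine ⟨∅, fun s t _ _ _ _ => ?_⟩
  rw [Path.refl_extend]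
  exact contMDiffOn_const

theorem IsPiecewiseC1.trans {a b c : X} {γ : Path a b} {δ : Path b c}
    (hγ : IsPiecewiseC1 E γ) (hδ : IsPiecewiseC1 E δ) : IsPiecewiseC1 E (γ.trans δ) := by
  obtain ⟨S, hS⟩ := hγ
  obtain ⟨S', hS'⟩ := hδ
  refine ⟨insert (1 / 2) (S.image (fun s => s / 2) ∪ S'.image (fun s => (s + 1) / 2)),
    fun s t hs hst ht hd => ?_⟩
  rw [Set.disjoint_left] at hd
  simp only [Finset.coe_insert, Finset.coe_union, Finset.coe_image, Set.mem_insert_iff,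
    Set.mem_union, Set.mem_image, Finset.mem_coe, not_or, not_exists, not_and] at hd
  have haff : ∀ k : ℝ, ContMDiff 𝓘(ℝ, ℝ) 𝓘(ℝ, ℝ) 1 (fun u : ℝ => 2 * u - k) := fun k =>
    ContDiff.contMDiff (by fun_prop)
  -- `1 / 2` is a break point, so `[s, t]` lies in one of the halves.
  rcases le_or_gt t (1 / 2) with h | h
  · have h1 := hS (2 * s - 0) (2 * t - 0) (by linarith) (by linarith) (by linarith) <| by
      rw [Set.disjoint_left]
      intro u hu huS
      exact ((hd (a := u / 2) ⟨by linarith [hu.1], by linarith [hu.2]⟩).2.1 u huS) rfl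
    refine (ContMDiffOn.comp (s := Icc s t) h1 (haff 0).contMDiffOn fun u hu => ?_).congr
      fun u hu => ?_
    · exact ⟨by linarith [hu.1], by linarith [hu.2]⟩
    · rw [Path.extend_trans_of_le_half _ _ (hu.2.trans h), Function.comp, sub_zero]
  · have h' : 1 / 2 ≤ s := by
      by_contra! hlt
      exact (hd (a := 1 / 2) ⟨hlt, h⟩).1 rfl
    have h1 := hS' (2 * s - 1) (2 * t - 1) (by linarith) (by linarith) (by linarith) <| by
      rw [Set.disjoint_left]
      intro u hu huS
      exact ((hd (a := (u + 1) / 2) ⟨by linarith [hu.1], by linarith [hu.2]⟩).2.2 u huS) rfl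
    refine (ContMDiffOn.comp (s := Icc s t) h1 (haff 1).contMDiffOn fun u hu => ?_).congr
      fun u hu => ?_
    · exact ⟨by linarith [hu.1], by linarith [hu.2]⟩
    · rw [Path.extend_trans_of_half_le _ _ (h'.trans hu.1), Function.comp]

/-- Every point has a neighbourhood (a ball in a chart) in which each path is homotopic to the
straight segment of the chart. -/
theorem exists_nhds_homotopic_isPiecewiseC1 [IsManifold 𝓘(ℝ, E) ∞ X] (x : X) :
    ∃ U : Set X, IsOpen U ∧ x ∈ U ∧ ∀ (a b : X) (γ : Path a b), (∀ t, γ t ∈ U) →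
      ∃ δ : Path a b, IsPiecewiseC1 E δ ∧ γ.Homotopic δ := by
  set φ := extChartAt 𝓘(ℝ, E) x with hφ
  obtain ⟨r, hr, hball⟩ := Metric.mem_nhds_iff.1 (extChartAt_target_mem_nhds (I := 𝓘(ℝ, E)) x)
  set B := Metric.ball (φ x) r
  have hB : Convex ℝ B := convex_ball _ _
  refine ⟨φ.source ∩ φ ⁻¹' B, (continuousOn_extChartAt x).isOpen_inter_preimage
    (isOpen_extChartAt_source x) Metric.isOpen_ball,
    ⟨mem_extChartAt_source x, Metric.mem_ball_self hr⟩, fun a b γ hγ => ?_⟩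
  have ha : a ∈ φ.source ∩ φ ⁻¹' B := by simpa using hγ 0
  have hb : b ∈ φ.source ∩ φ ⁻¹' B := by simpa using hγ 1
  have : ContractibleSpace B := hB.contractibleSpace ⟨_, Metric.mem_ball_self hr⟩
  let ψ : C(B, X) := ⟨fun z => φ.symm z, ((continuousOn_extChartAt_symm x).mono hball).domRestrict⟩
  let a' : B := ⟨φ a, ha.2⟩
  let b' : B := ⟨φ b, hb.2⟩
  have ha' : a = ψ a' := (φ.left_inv ha.1).symm
  have hb' : b = ψ b' := (φ.left_inv hb.1).symm
  let γ' : Path a' b' :=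
    { toFun := fun t => ⟨φ (γ t), (hγ t).2⟩
      continuous_toFun := by
        refine Continuous.subtype_mk ?_ _
        exact (continuousOn_extChartAt x).comp_continuous γ.continuous fun t => (hγ t).1
      source' := by simp [a']
      target' := by simp [b'] }
  have hl : ∀ t ∈ Icc (0 : ℝ) 1, AffineMap.lineMap (φ a) (φ b) t ∈ B := fun t ht =>
    hB.lineMap_mem ha.2 hb.2 ht
  let δ' : Path a' b' :=
    { toFun := fun t => ⟨AffineMap.lineMap (φ a) (φ b) (t : ℝ), hl t t.2⟩
      continuous_toFun := by
        refine Continuous.subtype_mk ?_ _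
        exact AffineMap.lineMap_continuous.comp continuous_subtype_val
      source' := by simp [a']
      target' := by simp [b'] }
  have hγ' : γ = (γ'.map ψ.continuous).cast ha' hb' := by
    ext t
    exact (φ.left_inv (hγ t).1).symm
  refine ⟨(δ'.map ψ.continuous).cast ha' hb', ⟨∅, fun s t hs hst ht _ => ?_⟩, ?_⟩
  · have h1 : ContMDiffOn 𝓘(ℝ, ℝ) 𝓘(ℝ, E) 1
        (φ.symm ∘ fun t : ℝ => AffineMap.lineMap (φ a) (φ b) t) (Icc s t) := by
      refine ((contMDiffOn_extChartAt_symm (I := 𝓘(ℝ, E)) (n := ∞) x).of_le (by simp)).comp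
        (ContDiff.contMDiff ?_).contMDiffOn fun u hu => ?_
      · simp only [AffineMap.lineMap_apply_module']
        fun_prop
      · exact hball (hl u ⟨hs.trans hu.1, hu.2.trans ht⟩)
    refine h1.congr fun u hu => ?_
    rw [Path.extend_apply _ ⟨hs.trans hu.1, hu.2.trans ht⟩]
    rfl
  · rw [hγ']
    exact homotopic_cast ((SimplyConnectedSpace.paths_homotopic γ' δ').map ψ) ha' hb'

/-- Every path in a manifold is homotopic to a piecewise `C¹` path: subdivide it so finely that each
piece lies in a ball of a chart. -/
theorem exists_isPiecewiseC1_homotopic [IsManifold 𝓘(ℝ, E) ∞ X] {a b : X} (γ : Path a b) :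
    ∃ δ : Path a b, IsPiecewiseC1 E δ ∧ γ.Homotopic δ := by
  choose U hU hxU hUγ using exists_nhds_homotopic_isPiecewiseC1 (E := E) (X := X)
  obtain ⟨t, t_0, t_mono, ⟨n_max, h_max⟩, t_sub⟩ :=
    exists_monotone_Icc_subset_open_cover_unitInterval
      (fun x => (hU x).preimage γ.continuous) fun t _ => Set.mem_iUnion.2 ⟨γ t, hxU _⟩
  have key : ∀ n, ∃ δ : Path (γ (t 0)) (γ (t n)), IsPiecewiseC1 E δ ∧
      (γ.subpath (t 0) (t n)).Homotopic δ := by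
    intro n
    induction n with
    | zero =>
      refine ⟨Path.refl _, isPiecewiseC1_refl _, ?_⟩
      rw [Path.subpath_self]
    | succ n ih =>
      obtain ⟨δ, hδ, hδ'⟩ := ih
      obtain ⟨x, hx⟩ := t_sub n
      obtain ⟨ε, hε, hε'⟩ := hUγ x _ _ (γ.subpath (t n) (t (n + 1))) fun s => by
        have : γ.subpath (t n) (t (n + 1)) s ∈ range (γ.subpath (t n) (t (n + 1))) := ⟨s, rfl⟩
        rw [Path.range_subpath_of_le _ _ _ (t_mono n.le_succ)] at this
        obtain ⟨u, hu, hu'⟩ := this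
        rw [← hu']
        exact hx hu
      refine ⟨δ.trans ε, hδ.trans hε, ?_⟩
      exact (Path.Homotopic.symm ⟨Path.Homotopy.subpathTransSubpath γ _ _ _⟩).trans
        (hδ'.hcomp hε')
  obtain ⟨δ, hδ, hδ'⟩ := key n_max
  have h0 : a = γ (t 0) := by rw [t_0]; simp
  have h1 : b = γ (t n_max) := by rw [h_max _ le_rfl]; simp
  refine ⟨δ.cast h0 h1, ?_, ?_⟩
  · obtain ⟨S, hS⟩ := hδ
    exact ⟨S, by simpa only [IsC1Off, Path.extend_cast] using hS⟩
  · have h2 : γ = (γ.subpath (t 0) (t n_max)).cast h0 h1 := by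
      ext s
      simp [Path.subpath, t_0, h_max _ le_rfl]
    exact Eq.subst (motive := fun η => Path.Homotopic η (δ.cast h0 h1)) h2.symm
      (homotopic_cast hδ' h0 h1)

theorem exists_isPiecewiseC1_loopClass_eq [IsManifold 𝓘(ℝ, E) ∞ X] {x : X} (a : PiOne X x) :
    ∃ γ : Path x x, IsPiecewiseC1 E γ ∧ loopClass γ = a := by
  obtain ⟨γ, hγ⟩ := Path.Homotopic.Quotient.mk_surjective (FundamentalGroup.toPath a.unop)
  obtain ⟨δ, hδ, h⟩ := exists_isPiecewiseC1_homotopic (E := E) γ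
  refine ⟨δ, hδ, ?_⟩
  have h' : Path.Homotopic.Quotient.mk δ = Path.Homotopic.Quotient.mk γ :=
    Path.Homotopic.Quotient.eq.2 h.symm
  rw [loopClass, h', hγ]
  rfl

theorem IsC1Off.map {E' X' : Type*} [NormedAddCommGroup E'] [NormedSpace ℝ E']
    [TopologicalSpace X'] [ChartedSpace E' X'] {f : X → X'}
    (hf : ContMDiff 𝓘(ℝ, E) 𝓘(ℝ, E') ∞ f) {a b : X} {γ : Path a b} {S : Finset ℝ}
    (hγ : IsC1Off E γ S) : IsC1Off E' (γ.map hf.continuous) S := fun s t hs hst ht hd =>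
  (hf.of_le (by simp)).comp_contMDiffOn (hγ s t hs hst ht hd)

end PiecewiseC1

/-! ### The holonomy homomorphism -/

section Holonomy

variable {EM EG EP : Type*}
  [NormedAddCommGroup EM] [NormedSpace ℝ EM]
  [NormedAddCommGroup EG] [NormedSpace ℝ EG]
  [NormedAddCommGroup EP] [NormedSpace ℝ EP]
  {G : Type*} [TopologicalSpace G] [ChartedSpace EG G] [Group G]
  {M P : Type*} [TopologicalSpace M] [ChartedSpace EM M]
  [TopologicalSpace P] [ChartedSpace EP P] [MulAction G P] {p : P → M} {α : LieForm EG EP G P}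

theorem IsPrincipalBundle.surjective (hp : IsPrincipalBundle EM EG EP G p) :
    Function.Surjective p := fun m => by
  obtain ⟨e, hb, -⟩ := hp.locally_trivial m
  exact ⟨_, e.proj_symm_apply' (x := 1) hb⟩

theorem IsPrincipalBundle.smul_left_injective (hp : IsPrincipalBundle EM EG EP G p) {g g' : G}
    {x : P} (h : g • x = g' • x) : g = g' := by
  obtain ⟨e, hb, he⟩ := hp.locally_trivial (p x)
  have hx : x ∈ e.source := e.mem_source.2 hb
  have := congrArg (fun y => (e y).2) h
  simpa [he.equivariant _ x hx] using this

/-- The holonomy homomorphism is determined by its values on piecewise `C¹` loops, as these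
represent all classes. -/
theorem IsHolonomyHom.unique [IsManifold 𝓘(ℝ, EM) ∞ M] (hp : IsPrincipalBundle EM EG EP G p)
    {x : P} {m : M} {h h' : PiOne M m →* G} (hh : IsHolonomyHom EM EG EP p α x m h)
    (hh' : IsHolonomyHom EM EG EP p α x m h') : h = h' := by
  ext a
  obtain ⟨γ, hγ, rfl⟩ := exists_isPiecewiseC1_loopClass_eq (E := EM) a
  obtain ⟨⟨y, c, hc⟩, hy⟩ := hh γ hγ
  exact hp.smul_left_injective ((hy y c hc).symm.trans ((hh' γ hγ).2 y c hc))

theorem existsUnique_isHolonomyHom [LieGroup 𝓘(ℝ, EG) ∞ G] [FiniteDimensional ℝ EG]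
    [IsManifold 𝓘(ℝ, EM) ∞ M] (hp : IsPrincipalBundle EM EG EP G p)
    (hflat : IsFlat EM EG EP p α) {x : P} {m : M} (hx : p x = m) :
    ∃! h : PiOne M m →* G, IsHolonomyHom EM EG EP p α x m h := by
  obtain ⟨h, hh⟩ := exists_isHolonomyHom hp hflat hx
  exact ⟨h, hh, fun h' hh' => hh'.unique hp hh⟩

theorem IsHolonomyHom.coe_range_eq_holonomyGroup [IsManifold 𝓘(ℝ, EM) ∞ M]
    (hp : IsPrincipalBundle EM EG EP G p) {x : P} {m : M} (hx : p x = m) {h : PiOne M m →* G}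
    (hh : IsHolonomyHom EM EG EP p α x m h) : (h.range : Set G) = holonomyGroup EG EP α x := by
  ext g
  constructor
  · rintro ⟨a, rfl⟩
    obtain ⟨γ, hγ, rfl⟩ := exists_isPiecewiseC1_loopClass_eq (E := EM) a
    obtain ⟨⟨y, c, hc⟩, hy⟩ := hh γ hγ
    obtain rfl := hy y c hc
    exact ⟨c, hc.1⟩
  · rintro ⟨c, hc⟩
    let γ : Path m m := (c.map hp.smooth_proj.continuous).cast hx.symm
      (hx.symm.trans (hp.proj_smul g x).symm)
    have hγ : IsPiecewiseC1 EM γ := by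
      obtain ⟨S, hS, -⟩ := hc
      refine ⟨S, ?_⟩
      have := hS.map hp.smooth_proj
      simpa only [IsC1Off, γ, Path.extend_cast] using this
    exact ⟨loopClass γ, hp.smul_left_injective ((hh γ hγ).2 _ c ⟨hc, fun t => rfl⟩).symm⟩

end Holonomy

/-! ### The induced bundle -/

namespace InducedBundle

variable {EM EG EP : Type*}
  [NormedAddCommGroup EM] [NormedSpace ℝ EM]
  [NormedAddCommGroup EG] [NormedSpace ℝ EG]
  [NormedAddCommGroup EP] [NormedSpace ℝ EP]
  {G : Type*} [TopologicalSpace G] [ChartedSpace EG G] [Group G]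
  {M M' P : Type*} [TopologicalSpace M] [ChartedSpace EM M]
  [TopologicalSpace M'] [ChartedSpace EM M']
  [TopologicalSpace P] [ChartedSpace EP P] [MulAction G P]
  {q : M' → M} {p : P → M}
  {hq : IsRegularCovering EM q} {hp : IsPrincipalBundle EM EG EP G p}

theorem coe_extChartAt (w : InducedBundle hq hp) :
    (extChartAt 𝓘(ℝ, EP) w : InducedBundle hq hp → EP) =
      extChartAt 𝓘(ℝ, EP) w.toTotal ∘ toTotal := by
  have h : (toTotal : InducedBundle hq hp → P) = (isLocalHomeomorph_toTotal w).choose :=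
    (isLocalHomeomorph_toTotal w).choose_spec.2
  rw [extChartAt_coe, extChartAt_coe, Function.comp_assoc]
  congr 1
  change ⇑(chart w) = _
  rw [chart, OpenPartialHomeomorph.coe_trans, ← h]

/-- The charts of the induced bundle are those of `P` read through `toTotal`, so smoothness of a
continuous map into the induced bundle is smoothness of its component in `P`. -/
theorem contMDiffWithinAt_iff {E : Type*} [NormedAddCommGroup E] [NormedSpace ℝ E] {H : Type*}
    [TopologicalSpace H] {I : ModelWithCorners ℝ E H} {N : Type*}
    [TopologicalSpace N] [ChartedSpace H N] {f : N → InducedBundle hq hp} {s : Set N} {a : N}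
    {n : WithTop ℕ∞} :
    ContMDiffWithinAt I 𝓘(ℝ, EP) n f s a ↔
      ContinuousWithinAt f s a ∧ ContMDiffWithinAt I 𝓘(ℝ, EP) n (fun b => (f b).toTotal) s a := by
  rw [_root_.contMDiffWithinAt_iff, _root_.contMDiffWithinAt_iff, coe_extChartAt]
  refine ⟨fun h => ⟨h.1, continuous_toTotal.continuousAt.comp_continuousWithinAt h.1, h.2⟩,
    fun h => ⟨h.1, h.2.2⟩⟩

theorem contMDiff_toTotal [IsManifold 𝓘(ℝ, EP) ∞ P] :
    ContMDiff 𝓘(ℝ, EP) 𝓘(ℝ, EP) ∞ (toTotal : InducedBundle hq hp → P) := fun _ =>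
  (contMDiffWithinAt_iff.1 contMDiffAt_id).2

/-- Near `z`, the projection to `M'` is a local inverse of `q` composed with the projection to `M`
through `P`. -/
theorem contMDiff_proj [IsManifold 𝓘(ℝ, EP) ∞ P] :
    ContMDiff 𝓘(ℝ, EP) 𝓘(ℝ, EM) ∞ (proj : InducedBundle hq hp → M') := by
  intro z
  have hz := hq.localDiffeo z.proj
  have h1 : ContMDiffAt 𝓘(ℝ, EM) 𝓘(ℝ, EM) ∞ hz.localInverse (p z.toTotal) :=
    z.comm ▸ hz.localInverse_contMDiffAt
  have h2 := h1.comp z ((hp.smooth_proj.comp contMDiff_toTotal) z)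
  refine h2.congr_of_eventuallyEq ?_
  filter_upwards [continuous_proj.continuousAt.eventually hz.localInverse_eventuallyEq_left]
    with w hw
  rw [Function.comp, Function.comp, ← w.comm]
  exact hw.symm

variable (hq hp) in
open Classical in
/-- The inverse of the trivialization induced by `e`, with an arbitrary point of the fibre as value
outside the domain. -/
noncomputable def trivializationInv (e : Trivialization G p) (w : M' × G) : InducedBundle hq hp :=
  if h : q w.1 ∈ e.baseSet then
    ⟨w.1, e.toOpenPartialHomeomorph.symm (q w.1, w.2), (e.proj_symm_apply' h).symm⟩
  else ⟨w.1, (hp.surjective (q w.1)).choose, (hp.surjective (q w.1)).choose_spec.symm⟩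

theorem trivializationInv_of_mem (e : Trivialization G p) {w : M' × G} (h : q w.1 ∈ e.baseSet) :
    trivializationInv hq hp e w =
      ⟨w.1, e.toOpenPartialHomeomorph.symm (q w.1, w.2), (e.proj_symm_apply' h).symm⟩ :=
  dif_pos h

variable (hq hp) in
/-- The trivialization of the induced bundle over `q ⁻¹(U)` induced by a trivialization over `U`. -/
noncomputable def trivialization (e : Trivialization G p) :
    Trivialization G (proj : InducedBundle hq hp → M') where
  toFun z := (z.proj, (e z.toTotal).2)
  invFun := trivializationInv hq hp e
  source := proj ⁻¹' (q ⁻¹' e.baseSet)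
  target := (q ⁻¹' e.baseSet) ×ˢ univ
  map_source' z hz := ⟨hz, mem_univ _⟩
  map_target' w hw := by
    have h : q w.1 ∈ e.baseSet := hw.1
    rwa [trivializationInv_of_mem e h]
  left_inv' z hz := by
    have h : q z.proj ∈ e.baseSet := hz
    rw [trivializationInv_of_mem e (w := (z.proj, (e z.toTotal).2)) h]
    refine ext' rfl ?_
    change e.toOpenPartialHomeomorph.symm (q z.proj, (e z.toTotal).2) = z.toTotal
    rw [z.comm]
    exact symm_mk_snd_eq (e.mem_source.2 (z.comm ▸ h)) rfl
  right_inv' w hw := by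
    have h : q w.1 ∈ e.baseSet := hw.1
    rw [trivializationInv_of_mem e h]
    refine Prod.ext rfl ?_
    have h' : e (e.toOpenPartialHomeomorph.symm (q w.1, w.2)) = (q w.1, w.2) :=
      e.toOpenPartialHomeomorph.right_inv (e.mem_target.2 h)
    simp only [h']
  open_source := (e.open_baseSet.preimage hq.covering.continuous).preimage continuous_proj
  open_target := (e.open_baseSet.preimage hq.covering.continuous).prod isOpen_univ
  continuousOn_toFun := by
    refine continuous_proj.continuousOn.prodMk (continuous_snd.comp_continuousOn ?_)
    exact e.toOpenPartialHomeomorph.continuousOn.comp continuous_toTotal.continuousOn fun z hz =>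
      e.mem_source.2 (z.comm ▸ hz)
  continuousOn_invFun := by
    rw [isInducing.continuousOn_iff]
    have h : ContinuousOn (fun w : M' × G => (w.1, e.toOpenPartialHomeomorph.symm (q w.1, w.2)))
        ((q ⁻¹' e.baseSet) ×ˢ univ) := by
      refine continuousOn_fst.prodMk ?_
      refine e.toOpenPartialHomeomorph.continuousOn_symm.comp
        ((hq.covering.continuous.comp continuous_fst).prodMk continuous_snd).continuousOn ?_
      exact fun w hw => e.mem_target.2 hw.1
    refine h.congr fun w hw => ?_
    have h : q w.1 ∈ e.baseSet := hw.1
    rw [Function.comp, trivializationInv_of_mem e h]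
  baseSet := q ⁻¹' e.baseSet
  open_baseSet := e.open_baseSet.preimage hq.covering.continuous
  source_eq := rfl
  target_eq := rfl
  proj_toFun _ _ := rfl

theorem mem_trivialization_source (e : Trivialization G p) (z : InducedBundle hq hp) :
    z ∈ (trivialization hq hp e).source ↔ z.toTotal ∈ e.source := by
  rw [e.mem_source, ← z.comm]
  rfl

theorem toTotal_trivialization_symm (e : Trivialization G p) {w : M' × G}
    (hw : w ∈ (trivialization hq hp e).target) :
    ((trivialization hq hp e).toOpenPartialHomeomorph.symm w).toTotal =
      e.toOpenPartialHomeomorph.symm (q w.1, w.2) := by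
  have h : q w.1 ∈ e.baseSet := hw.1
  exact congrArg toTotal (trivializationInv_of_mem e h)

theorem isPrincipalTrivialization_trivialization [IsManifold 𝓘(ℝ, EP) ∞ P] {e : Trivialization G p}
    (he : IsPrincipalTrivialization EM EG EP e) :
    IsPrincipalTrivialization EM EG EP (trivialization hq hp e) where
  smooth := by
    refine contMDiff_proj.contMDiffOn.prodMk fun z hz => ContMDiffAt.contMDiffWithinAt ?_
    exact (he.contMDiffAt_snd ((mem_trivialization_source e z).1 hz)).comp z (contMDiff_toTotal z)
  smooth_symm := fun w hw => by
    refine contMDiffWithinAt_iff.2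
      ⟨(trivialization hq hp e).toOpenPartialHomeomorph.continuousOn_symm w hw, ?_⟩
    have h : ContMDiffOn (𝓘(ℝ, EM).prod 𝓘(ℝ, EG)) 𝓘(ℝ, EP) ∞
        (fun w : M' × G => e.toOpenPartialHomeomorph.symm (q w.1, w.2))
        (trivialization hq hp e).target :=
      he.smooth_symm.comp
        ((hq.localDiffeo.contMDiff.comp contMDiff_fst).prodMk contMDiff_snd).contMDiffOn
        fun w hw => e.mem_target.2 hw.1
    exact (h w hw).congr (fun w hw => toTotal_trivialization_symm e hw)
      (toTotal_trivialization_symm e hw)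
  equivariant g z hz :=
    Prod.ext rfl (congrArg (fun w : M × G => w.2)
      (he.equivariant g z.toTotal ((mem_trivialization_source e z).1 hz)))

theorem contMDiff_smul [IsManifold 𝓘(ℝ, EP) ∞ P] :
    ContMDiff (𝓘(ℝ, EG).prod 𝓘(ℝ, EP)) 𝓘(ℝ, EP) ∞
      (fun w : G × InducedBundle hq hp => w.1 • w.2) := by
  have h : ContMDiff (𝓘(ℝ, EG).prod 𝓘(ℝ, EP)) 𝓘(ℝ, EP) ∞
      (fun w : G × InducedBundle hq hp => w.1 • w.2.toTotal) :=
    hp.smooth_smul.comp (contMDiff_fst.prodMk (contMDiff_toTotal.comp contMDiff_snd))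
  have hc : Continuous (fun w : G × InducedBundle hq hp => w.1 • w.2) :=
    isInducing.continuous_iff.2 ((continuous_proj.comp continuous_snd).prodMk h.continuous)
  exact fun w => contMDiffWithinAt_iff.2 ⟨hc.continuousAt.continuousWithinAt, h w⟩

theorem isPrincipalBundle [IsManifold 𝓘(ℝ, EP) ∞ P] :
    IsPrincipalBundle EM EG EP G (proj : InducedBundle hq hp → M') where
  smooth_smul := contMDiff_smul
  smooth_proj := contMDiff_proj
  proj_smul _ _ := rfl
  locally_trivial m := by
    obtain ⟨e, hm, he⟩ := hp.locally_trivial (q m)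
    exact ⟨trivialization hq hp e, hm, isPrincipalTrivialization_trivialization he⟩

variable {α : LieForm EG EP G P}

/-- The chain rule for `toTotal`. -/
theorem inducedForm_mfderiv [IsManifold 𝓘(ℝ, EP) ∞ P] {E : Type*} [NormedAddCommGroup E]
    [NormedSpace ℝ E] {N : Type*} [TopologicalSpace N] [ChartedSpace E N]
    {f : N → InducedBundle hq hp} {t : N} (hf : MDifferentiableAt 𝓘(ℝ, E) 𝓘(ℝ, EP) f t)
    (v : TangentSpace 𝓘(ℝ, E) t) :
    inducedForm hq hp α (f t) (mfderiv 𝓘(ℝ, E) 𝓘(ℝ, EP) f t v) =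
      α (f t).toTotal (mfderiv 𝓘(ℝ, E) 𝓘(ℝ, EP) (fun s => (f s).toTotal) t v) := by
  have h : mfderiv 𝓘(ℝ, E) 𝓘(ℝ, EP) (fun s => (f s).toTotal) t = _ :=
    mfderiv_comp t (contMDiff_toTotal.mdifferentiableAt (by simp)) hf
  rw [h]
  rfl

theorem isFlat_inducedForm [IsManifold 𝓘(ℝ, EP) ∞ P] (hflat : IsFlat EM EG EP p α) :
    IsFlat EM EG EP (proj : InducedBundle hq hp → M') (inducedForm hq hp α) := by
  intro m
  obtain ⟨e, hm, he, hα⟩ := hflat (q m)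
  refine ⟨trivialization hq hp e, hm, isPrincipalTrivialization_trivialization he,
    fun z hz v => ?_⟩
  have hz' := (mem_trivialization_source e z).1 hz
  have h : mfderiv 𝓘(ℝ, EP) 𝓘(ℝ, EG) (fun w : InducedBundle hq hp => (e w.toTotal).2) z = _ :=
    mfderiv_comp (g := fun y => (e y).2) z ((he.contMDiffAt_snd hz').mdifferentiableAt (by simp))
      (contMDiff_toTotal.mdifferentiableAt (by simp))
  change α z.toTotal _ = maurerCartan EG (e z.toTotal).2 (mfderiv 𝓘(ℝ, EP) 𝓘(ℝ, EG)
    (fun w : InducedBundle hq hp => (e w.toTotal).2) z v)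
  rw [hα _ hz', h]
  rfl

theorem isConnectionForm_inducedForm [LieGroup 𝓘(ℝ, EG) ∞ G] [IsManifold 𝓘(ℝ, EP) ∞ P]
    (hα : IsConnectionForm EG EP α) :
    IsConnectionForm EG EP (inducedForm hq hp α) where
  smooth := hα.smooth.comp (contMDiff_toTotal.contMDiff_tangentMap (m := ∞) (by simp))
  fundamental z A := by
    have hf : MDifferentiableAt 𝓘(ℝ, EG) 𝓘(ℝ, EP) (fun g : G => g • z) 1 :=
      (contMDiff_smul.comp (contMDiff_id.prodMk contMDiff_const)).mdifferentiableAt (by simp)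
    exact (inducedForm_mfderiv hf A).trans (hα.fundamental z.toTotal A)
  equivariant g z v := by
    have hf : MDifferentiableAt 𝓘(ℝ, EP) 𝓘(ℝ, EP) (fun w : InducedBundle hq hp => g • w) z :=
      (contMDiff_smul.comp (contMDiff_const.prodMk contMDiff_id)).mdifferentiableAt (by simp)
    have hg : MDifferentiableAt 𝓘(ℝ, EP) 𝓘(ℝ, EP) (fun y : P => g • y) z.toTotal :=
      (hp.smooth_smul.comp (contMDiff_const.prodMk contMDiff_id)).mdifferentiableAt (by simp)
    have h : mfderiv 𝓘(ℝ, EP) 𝓘(ℝ, EP) (fun w : InducedBundle hq hp => g • w.toTotal) z = _ :=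
      mfderiv_comp (g := fun y => g • y) z hg (contMDiff_toTotal.mdifferentiableAt (by simp))
    refine (inducedForm_mfderiv hf v).trans ?_
    refine Eq.trans ?_ (hα.equivariant g z.toTotal
      (mfderiv 𝓘(ℝ, EP) 𝓘(ℝ, EP) (toTotal : InducedBundle hq hp → P) z v))
    exact congrArg (fun L => α (g • z.toTotal) (L v)) h

theorem isHorizontal_map_toTotal [IsManifold 𝓘(ℝ, EP) ∞ P] {z w : InducedBundle hq hp}
    {c : Path z w} (hc : IsHorizontal EG EP (inducedForm hq hp α) c) :
    IsHorizontal EG EP α (c.map continuous_toTotal) := by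
  obtain ⟨S, hS, h⟩ := hc
  refine ⟨S, hS.map contMDiff_toTotal, fun t ht htS => ?_⟩
  exact (inducedForm_mfderiv ((hS.contMDiffAt ht htS).mdifferentiableAt (by simp))
    (1 : ℝ)).symm.trans (h t ht htS)

/-- Horizontal lifts to the induced bundle project to horizontal lifts to `P`, so the holonomy of
the induced form is the restriction of that of `α`. -/
theorem holonomyHom_eq_comp [IsManifold 𝓘(ℝ, EM) ∞ M'] [IsManifold 𝓘(ℝ, EP) ∞ P]
    {z : InducedBundle hq hp} {h : PiOne M (q z.proj) →* G} {h' : PiOne M' z.proj →* G}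
    (hh : IsHolonomyHom EM EG EP p α z.toTotal (q z.proj) h)
    (hh' : IsHolonomyHom EM EG EP (proj : InducedBundle hq hp → M') (inducedForm hq hp α) z
      z.proj h') :
    h' = h.comp (piOneMap hq.toContinuousMap z.proj) := by
  ext a
  obtain ⟨γ, hγ, rfl⟩ := exists_isPiecewiseC1_loopClass_eq (E := EM) a
  obtain ⟨⟨y, c, hc⟩, hy⟩ := hh' γ hγ
  obtain rfl := hy y c hc
  obtain ⟨S, hS⟩ := hγ
  have hqγ : IsPiecewiseC1 EM (γ.map hq.covering.continuous) :=
    ⟨S, hS.map hq.localDiffeo.contMDiff⟩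
  have hlift : IsHorizontalLift EG EP p α (γ.map hq.covering.continuous)
      (c.map continuous_toTotal) := by
    refine ⟨isHorizontal_map_toTotal hc.1, fun t => ?_⟩
    exact (c t).comm.symm.trans (congrArg q (hc.2 t))
  exact hp.smul_left_injective ((hh _ hqγ).2 _ _ hlift)

end InducedBundle

end FlatCovering

open FlatCovering in
theorem theorem0p1
    {EM EG EP : Type*}
    [NormedAddCommGroup EM] [NormedSpace ℝ EM] [FiniteDimensional ℝ EM]
    [NormedAddCommGroup EG] [NormedSpace ℝ EG] [FiniteDimensional ℝ EG]
    [NormedAddCommGroup EP] [NormedSpace ℝ EP] [FiniteDimensional ℝ EP]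
    -- the Lie group `G`
    {G : Type*} [TopologicalSpace G] [ChartedSpace EG G] [Group G] [LieGroup 𝓘(ℝ, EG) ∞ G]
    -- the connected paracompact manifolds `M` and `P`, and the principal bundle `P(M, G)`
    {M : Type*} [TopologicalSpace M] [ChartedSpace EM M] [IsManifold 𝓘(ℝ, EM) ∞ M]
    [T2Space M] [ParacompactSpace M] [ConnectedSpace M]
    {P : Type*} [TopologicalSpace P] [ChartedSpace EP P] [IsManifold 𝓘(ℝ, EP) ∞ P]
    [T2Space P] [ParacompactSpace P] [ConnectedSpace P] [MulAction G P]
    {p : P → M} (hp : IsPrincipalBundle EM EG EP G p)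
    -- the regular covering `q : M' → M`
    {M' : Type*} [TopologicalSpace M'] [ChartedSpace EM M'] [IsManifold 𝓘(ℝ, EM) ∞ M']
    [ConnectedSpace M'] {q : M' → M} (hq : IsRegularCovering EM q)
    -- the flat connection `α`
    (α : LieForm EG EP G P) (hα : IsConnectionForm EG EP α) (hflat : IsFlat EM EG EP p α) :
    -- the induced bundle is a principal bundle and the induced form is a flat connection on it
    IsPrincipalBundle EM EG EP G (InducedBundle.proj : InducedBundle hq hp → M') ∧
    IsConnectionForm EG EP (InducedBundle.inducedForm hq hp α) ∧
    IsFlat EM EG EP (InducedBundle.proj : InducedBundle hq hp → M')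
      (InducedBundle.inducedForm hq hp α) ∧
    ∀ z : InducedBundle hq hp,
      -- both holonomy homomorphisms are well defined
      (∃! h : PiOne M (q z.proj) →* G,
        IsHolonomyHom EM EG EP p α z.toTotal (q z.proj) h) ∧
      (∃! h' : PiOne M' z.proj →* G,
        IsHolonomyHom EM EG EP (InducedBundle.proj : InducedBundle hq hp → M')
          (InducedBundle.inducedForm hq hp α) z z.proj h') ∧
      -- the image of `h'` is the holonomy group, and equals `h (π₁(M'))`
      ∀ (h : PiOne M (q z.proj) →* G) (h' : PiOne M' z.proj →* G),
        IsHolonomyHom EM EG EP p α z.toTotal (q z.proj) h →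
        IsHolonomyHom EM EG EP (InducedBundle.proj : InducedBundle hq hp → M')
          (InducedBundle.inducedForm hq hp α) z z.proj h' →
        (h'.range : Set G) = holonomyGroup EG EP (InducedBundle.inducedForm hq hp α) z ∧
        h'.range = (piOneMap hq.toContinuousMap z.proj).range.map h := by
  refine ⟨InducedBundle.isPrincipalBundle, InducedBundle.isConnectionForm_inducedForm hα,
    InducedBundle.isFlat_inducedForm hflat, fun z =>
      ⟨existsUnique_isHolonomyHom hp hflat z.comm.symm,
        existsUnique_isHolonomyHom InducedBundle.isPrincipalBundle
          (InducedBundle.isFlat_inducedForm hflat) rfl, fun h h' hh hh' =>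
        ⟨hh'.coe_range_eq_holonomyGroup InducedBundle.isPrincipalBundle rfl, ?_⟩⟩⟩
  rw [InducedBundle.holonomyHom_eq_comp hh hh']
  exact (MonoidHom.map_range h (piOneMap hq.toContinuousMap z.proj)).symm
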